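/- All graphs are finite and simple. A graph is \emph{strongly chordal} if it has no induced cycle $C_p$ with $p\ge 4$ and no induced $n$-sun $S_n$ with $n\ge 3$, where $S_n$ has vertices $u_1,\dots,u_n,v_1,\dots,v_n$, the $u_j$ form a clique, the $v_i$ are pairwise non-adjacent, and $v_i$ is adjacent exactly to $u_i$ and $u_{i+1}$ (with $u_{n+1}=u_1$). A non-empty finite poset $\mathcal P$ is \emph{graded} by $\operatorname{rk}\colon\mathcal P\to\mathbb Z_{>0}$ if $x<y$ implies $\operatorname{rk}(x)<\operatorname{rk}(y)$, $\operatorname{rk}(y)=\operatorname{rk}(x)+1$ whenever $y$ covers $x$, and $\operatorname{rk}(x)=1$ for every minimal $x$. Its rank is $\max_x\operatorname{rk}(x)$, and its dimension is the number of its minimal elements. A graded poset $\mathcal P$ of rank $n$ is a \emph{vine} if every non-minimal element covers exactly two elements, any two distinct elements of the same rank are covered by at most one common element, and for each $1\le i\le n$ the graph $F_i$ is a forest, where the vertices of $F_i$ are the elements of rank $i$ and its edges are the pairs $\{a,b\}$ of elements covered by an element of rank $i+1$. A vine is an \emph{R-vine} if its rank equals its dimension, every $F_i$ ($1\le i\le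 n$) is a tree, and any two distinct elements of the same rank $i\ge 2$ covered by a common element cover a common element. A vine $\mathcal P$ is an \emph{LR-vine} if every principal ideal $\mathcal P_{\le a}=\{x\in\mathcal P: x\le a\}$, with the induced order and rank, is an R-vine. \textbf{Theorem.} Let $G$ be a strongly chordal graph with non-empty vertex set $N_G$. Then there exist an LR-vine $\mathcal P$ and a bijection $e$ from $N_G$ onto the set $\min(\mathcal P)$ of minimal elements of $\mathcal P$ such that $a\mapsto\{v\in N_G : e(v)\le a\}$ is a bijection from the set of maximal elements of $\mathcal P$ onto the set of maximal cliques of $G$. Equally, $I\mapsto\{v\in N_G : e(v)\in I\}$ is a bijection from the set of principal ideals generated by the maximal elements of $\mathcal P$ onto the set of maximal cliques of $G$. -/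

import Mathlib

universe u

/-- The `n`-sun: vertices `u_j = inl j` and `v_i = inr i` (indices modulo `n`); the `u_j` form a
clique, the `v_i` are pairwise non-adjacent, and `v_i` is adjacent exactly to `u_i` and `u_{i+1}`. -/
def sunGraph (n : ℕ) : SimpleGraph (Fin n ⊕ Fin n) where
  Adj
    | .inl i, .inl j => i ≠ j
    | .inl j, .inr i => (j : ℕ) = i ∨ (j : ℕ) = (i + 1) % n
    | .inr i, .inl j => (j : ℕ) = i ∨ (j : ℕ) = (i + 1) % n
    | .inr _, .inr _ => False
  symm := ⟨by
    rintro (i | i) (j | j) h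
    · exact Ne.symm h
    · exact h
    · exact h
    · exact h⟩
  loopless := ⟨by
    rintro (i | i) h
    · exact h rfl
    · exact h⟩

/-- No induced cycle of length at least four and no induced `n`-sun for `n ≥ 3`. -/
def IsStronglyChordal {V : Type u} (G : SimpleGraph V) : Prop :=
  (∀ p : ℕ, 4 ≤ p → ¬ (SimpleGraph.cycleGraph p).IsIndContained G) ∧
  (∀ n : ℕ, 3 ≤ n → ¬ (sunGraph n).IsIndContained G)

namespace Vine

/-- `rk` is a rank function of the poset `P`, normalised to be `1` on the minimal elements. -/
structure IsRankFunction (P : Type u) [PartialOrder P] (rk : P → ℕ) : Prop where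
  lt_of_lt : ∀ x y : P, x < y → rk x < rk y
  covBy : ∀ x y : P, x ⋖ y → rk y = rk x + 1
  of_isMin : ∀ x : P, IsMin x → rk x = 1

/-- The rank of a finite poset graded by `rk`: the largest value of `rk`. -/
noncomputable def rank (P : Type u) (rk : P → ℕ) : ℕ := ⨆ x : P, rk x

/-- The dimension of a finite poset: its number of minimal elements. -/
noncomputable def dim (P : Type u) [PartialOrder P] : ℕ := {x : P | IsMin x}.ncard

/-- The set of elements covered by `v`. -/
def coveredBy {P : Type u} [PartialOrder P] (v : P) : Set P := {x | x ⋖ v}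

/-- The `i`-th associated graph: its nodes are the elements of rank `i`, and its edges are the
sets of elements covered by the elements of rank `i + 1`. -/
def assocGraph (P : Type u) [PartialOrder P] (rk : P → ℕ) (i : ℕ) :
    SimpleGraph {x : P // rk x = i} where
  Adj a b := a ≠ b ∧ ∃ v : P, rk v = i + 1 ∧ coveredBy v = {a.1, b.1}
  symm := ⟨by
    rintro a b ⟨hab, v, hv, h⟩
    exact ⟨hab.symm, v, hv, by rw [h, Set.pair_comm]⟩⟩
  loopless := ⟨fun _ h => h.1 rfl⟩

/-- A vine, as a (non-empty) finite graded poset. -/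
structure IsVine (P : Type u) [PartialOrder P] (rk : P → ℕ) : Prop where
  finite : Finite P
  nonempty : Nonempty P
  graded : IsRankFunction P rk
  covers_two : ∀ v : P, ¬ IsMin v → (coveredBy v).ncard = 2
  covered_unique : ∀ a b : P, a ≠ b → rk a = rk b →
    ∀ v w : P, a ⋖ v → b ⋖ v → a ⋖ w → b ⋖ w → v = w
  forest : ∀ i : ℕ, 1 ≤ i → i ≤ rank P rk → (assocGraph P rk i).IsAcyclic

/-- A regular vine (R-vine). -/
structure IsRVine (P : Type u) [PartialOrder P] (rk : P → ℕ) : Prop where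
  isVine : IsVine P rk
  rank_eq_dim : rank P rk = dim P
  tree : ∀ i : ℕ, 1 ≤ i → i ≤ rank P rk → (assocGraph P rk i).IsTree
  proximity : ∀ i : ℕ, 2 ≤ i → ∀ a b : P, a ≠ b → rk a = i → rk b = i →
    (∃ v : P, a ⋖ v ∧ b ⋖ v) → ∃ c : P, c ⋖ a ∧ c ⋖ b

/-- A locally regular vine (LR-vine): a vine all of whose principal ideals, with the induced order
and the restricted rank function, are R-vines. -/
structure IsLRVine (P : Type u) [PartialOrder P] (rk : P → ℕ) : Prop where
  isVine : IsVine P rk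
  locally_regular : ∀ a : P, IsRVine (Set.Iic a) (fun x => rk x.1)

end Vine

/-- The maximal cliques of a graph, as sets of vertices. -/
def maximalCliques {V : Type u} (G : SimpleGraph V) : Set (Set V) :=
  {C | Maximal (fun S : Set V => G.IsClique S) C}

/-- The principal ideals generated by the maximal elements of a poset. -/
def maximalPrincipalIdeals (P : Type u) [PartialOrder P] : Set (Set P) :=
  {I | ∃ a : P, IsMax a ∧ I = Set.Iic a}

/-! Order the vertices so that the closed neighbourhood matrix is doubly lexical
(`exists_isDoublyLexical`). In such an order, excluding long induced cycles makes the later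
neighbours of each vertex a clique (`IsDoublyLexical.isPerfectElimination`). Excluding suns as well
makes the sets of neighbours above `u`, for the vertices `v ≤ u` in the closed neighbourhood of `u`,
increase with `v` (`IsDoublyLexical.isStrongElimination`). Both are proved by extremal growth: a
violation can be prolonged for ever unless it closes up to a forbidden subgraph, and finiteness
rules out the former.

Working from the last vertex down, `exists_chainCondition` then gives each `u` a chain `C u` of sets
of later neighbours. It contains `∅` and all the nested sets above, has no gaps in cardinality, and
each non-empty member is again `insert w B` with `B ∈ C w`. The vine consists of all sets `insert w
B` with `B ∈ C w`, ordered by inclusion and ranked by cardinality. Such a set of size at least two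
covers exactly its tail `B` and `insert w B'`, where `B'` precedes `B` in `C w`. Uniqueness,
acyclicity, proximity and connectedness all follow from this description (`IsFamilyIdeal.isLRVine`).

Every member is a clique. A non-empty clique with least vertex `w` lies in the member formed by `w`
and all its later neighbours, so the maximal members are the maximal cliques
(`bijOn_maximalCliques`). -/

namespace SimpleGraph

/-! ### Doubly lexical vertex orders -/

/-- Membership in the closed neighbourhood. -/
def ClosedAdj {V : Type u} (G : SimpleGraph V) (x y : V) : Prop := x = y ∨ G.Adj x y

theorem ClosedAdj.symm {V : Type u} {G : SimpleGraph V} {x y : V} (h : G.ClosedAdj x y) :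
    G.ClosedAdj y x := h.imp Eq.symm SimpleGraph.Adj.symm

theorem closedAdj_comm {V : Type u} {G : SimpleGraph V} {x y : V} :
    G.ClosedAdj x y ↔ G.ClosedAdj y x := ⟨ClosedAdj.symm, ClosedAdj.symm⟩

/-- For `u < w`, the largest vertex in the symmetric difference of the closed neighbourhoods of
`u` and `w` belongs to that of `w`. -/
def IsDoublyLexical {V : Type u} [LinearOrder V] (G : SimpleGraph V) : Prop :=
  ∀ u w k : V, u < w → G.ClosedAdj u k → ¬ G.ClosedAdj w k →
    ∃ k', k < k' ∧ G.ClosedAdj w k' ∧ ¬ G.ClosedAdj u k'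

-- Give the vertex at position `i` the weight `2 ^ i` and maximise the quadratic form of the closed
-- neighbourhood matrix over all orders. Exchanging `u` and `w` adds a multiple of `e_u - e_w`, on
-- which the form is non-negative because the diagonal entries are `1`. Optimality therefore forces
-- the weighted row sums to increase along the order, and sums of distinct powers of two compare
-- lexicographically from the top.
open Classical in
theorem exists_isDoublyLexical {V : Type u} [Finite V] (G : SimpleGraph V) :
    ∃ _ : LinearOrder V, G.IsDoublyLexical := by
  have := Fintype.ofFinite V
  let M : Matrix V V ℤ := fun a b => if G.ClosedAdj a b then 1 else 0
  have hMs : ∀ a b, M a b = M b a := fun a b => by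
    simp only [M, closedAdj_comm (x := a) (y := b)]
  have hMt : M.transpose = M := by ext a b; exact hMs b a
  let X : (V ≃ Fin (Fintype.card V)) → V → ℤ := fun σ v => 2 ^ (σ v : ℕ)
  have : Nonempty (V ≃ Fin (Fintype.card V)) := ⟨Fintype.equivFin V⟩
  obtain ⟨σ, hσ⟩ := Finite.exists_max (fun σ => X σ ⬝ᵥ M.mulVec (X σ))
  have key : ∀ u w, σ u < σ w → M.mulVec (X σ) u ≤ M.mulVec (X σ) w := by
    intro u w huw
    have h := hσ ((Equiv.swap u w).trans σ)
    have hne : u ≠ w := fun h => by simp [h] at huw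
    set δ : ℤ := X σ w - X σ u with hδ
    have hδpos : 0 < δ := by
      simp only [hδ, X, sub_pos]
      exact pow_lt_pow_right₀ (by norm_num) huw
    set d : V → ℤ := δ • (Pi.single u 1 - Pi.single w 1) with hd
    have hX : X ((Equiv.swap u w).trans σ) = X σ + d := by
      ext v
      by_cases h1 : v = u
      · subst h1; simp [X, hd, hδ, hne]
      · by_cases h2 : v = w
        · subst h2; simp [X, hd, hδ, h1]
        · simp [X, hd, h1, h2, Equiv.swap_apply_of_ne_of_ne]
    have hsym : X σ ⬝ᵥ M.mulVec d = d ⬝ᵥ M.mulVec (X σ) := by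
      rw [Matrix.dotProduct_mulVec, ← Matrix.mulVec_transpose, hMt, dotProduct_comm]
    have hdot : ∀ y : V → ℤ, d ⬝ᵥ y = δ * (y u - y w) := fun y => by
      rw [hd, smul_dotProduct, sub_dotProduct]
      simp
    have e1 : d ⬝ᵥ M.mulVec (X σ) = δ * (M.mulVec (X σ) u - M.mulVec (X σ) w) := hdot _
    have e2 : d ⬝ᵥ M.mulVec d = δ * (δ * (2 - 2 * M u w)) := by
      rw [hdot, hd]
      have h1 : M u u = 1 := by simp [M, ClosedAdj]
      have h2 : M w w = 1 := by simp [M, ClosedAdj]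
      simp only [Matrix.mulVec_smul, Matrix.mulVec_sub, Matrix.mulVec_single_one, Pi.smul_apply,
        Pi.sub_apply, Matrix.col_apply, smul_eq_mul, h1, h2, hMs w u]
      ring
    have hle : 0 ≤ 2 - 2 * M u w := by
      simp only [M]; split_ifs <;> norm_num
    rw [hX, Matrix.mulVec_add, dotProduct_add, add_dotProduct, add_dotProduct, hsym, e1, e2] at h
    have h3 : 0 ≤ δ * (δ * (2 - 2 * M u w)) := by positivity
    have h4 : δ * (M.mulVec (X σ) u - M.mulVec (X σ) w) ≤ 0 := by linarith
    by_contra hc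
    push Not at hc
    have := mul_pos hδpos (sub_pos.2 hc)
    linarith
  refine ⟨LinearOrder.lift' σ σ.injective, ?_⟩
  intro u w k huw huk hwk
  have huw' : σ u < σ w := huw
  by_contra hcon
  have hcon' : ∀ k', G.ClosedAdj w k' → ¬ G.ClosedAdj u k' → σ k' < σ k := by
    intro k' h1 h2
    by_contra h3
    rcases (not_lt.1 h3).lt_or_eq with h4 | h4
    · exact hcon ⟨k', h4, h1, h2⟩
    · rw [σ.injective h4] at hwk
      exact hwk h1
  have hk := key u w huw'
  have hsum : ∀ a, M.mulVec (X σ) a =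
      ∑ l ∈ Finset.univ.filter (fun l => G.ClosedAdj a l), X σ l := by
    intro a
    simp [Matrix.mulVec, dotProduct, M, Finset.sum_filter]
  -- The common neighbours cancel. What remains contradicts the fact that the weight of `k` exceeds
  -- any sum of distinct smaller powers of two.
  rw [hsum, hsum, ← Finset.sum_inter_add_sum_sdiff _ (Finset.univ.filter fun l => G.ClosedAdj w l),
    ← Finset.sum_inter_add_sum_sdiff (Finset.univ.filter fun l => G.ClosedAdj w l)
      (Finset.univ.filter fun l => G.ClosedAdj u l), Finset.inter_comm] at hk
  have hk2 := le_of_add_le_add_left hk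
  have hlow : X σ k ≤ ∑ l ∈ (Finset.univ.filter fun l => G.ClosedAdj u l) \
      (Finset.univ.filter fun l => G.ClosedAdj w l), X σ l := by
    refine Finset.single_le_sum (f := X σ) (fun i _ => by simp [X]) ?_
    simp [huk, hwk]
  have hup : ∑ l ∈ (Finset.univ.filter fun l => G.ClosedAdj w l) \
      (Finset.univ.filter fun l => G.ClosedAdj u l), X σ l < X σ k := by
    set S := (Finset.univ.filter fun l => G.ClosedAdj w l) \
      (Finset.univ.filter fun l => G.ClosedAdj u l) with hS
    have h1 : ∑ l ∈ S, (2 : ℕ) ^ (σ l : ℕ) < 2 ^ (σ k : ℕ) := by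
      have h2 : ∑ j ∈ S.image (fun l => (σ l : ℕ)), (2 : ℕ) ^ j = ∑ l ∈ S, 2 ^ (σ l : ℕ) :=
        Finset.sum_image fun a _ b _ hab => σ.injective (Fin.ext hab)
      rw [← h2]
      refine Nat.geomSum_lt le_rfl fun j hj => ?_
      obtain ⟨l, hl, rfl⟩ := Finset.mem_image.1 hj
      simp only [hS, Finset.mem_sdiff, Finset.mem_filter, Finset.mem_univ, true_and] at hl
      exact hcon' l hl.1 hl.2
    simp only [X]
    exact_mod_cast h1
  linarith

end SimpleGraph

/-! ### Recognising cycles and suns from zigzag adjacency patterns -/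

namespace SimpleGraph

/-- The position on a closed cycle that zigzags outwards from `0`: the indices below `n` are
visited in the cyclic order `0, 1, 3, 5, …, 6, 4, 2`. -/
def zigzag (n p : ℕ) : ℕ := if p = 0 then 0 else if 2 * p ≤ n then 2 * p - 1 else 2 * (n - p)

/-- The order `0, 2, 4, …, 5, 3, 1` in which the gaps of `zigzag` are visited. -/
def zigzagGap (n p : ℕ) : ℕ := if 2 * p + 1 ≤ n then 2 * p else 2 * (n - p) - 1

theorem zigzag_spec (n p : ℕ) : (p = 0 ∧ zigzag n p = 0) ∨
    (0 < p ∧ 2 * p ≤ n ∧ zigzag n p = 2 * p - 1) ∨ (n < 2 * p ∧ zigzag n p = 2 * (n - p)) := by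
  unfold zigzag; split_ifs <;> omega

theorem zigzagGap_spec (n p : ℕ) : (2 * p + 1 ≤ n ∧ zigzagGap n p = 2 * p) ∨
    (n < 2 * p + 1 ∧ zigzagGap n p = 2 * (n - p) - 1) := by
  unfold zigzagGap; split_ifs <;> omega

theorem zigzag_lt {n p : ℕ} (hp : p < n) : zigzag n p < n := by
  unfold zigzag; split_ifs <;> omega

theorem zigzagGap_lt {n p : ℕ} (hp : p < n) : zigzagGap n p < n := by
  unfold zigzagGap; split_ifs <;> omega

theorem zigzag_inj {n p q : ℕ} (hp : p < n) (hq : q < n) (h : zigzag n p = zigzag n q) :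
    p = q := by
  unfold zigzag at h; split_ifs at h <;> omega

theorem zigzagGap_inj {n p q : ℕ} (hp : p < n) (hq : q < n)
    (h : zigzagGap n p = zigzagGap n q) : p = q := by
  unfold zigzagGap at h; split_ifs at h <;> omega

theorem zigzag_adj_iff {n p q : ℕ} (hn : 3 ≤ n) (hp : p < n) (hq : q < n)
    (h : zigzag n p < zigzag n q) :
    ((zigzag n p = 0 ∧ zigzag n q = 1) ∨ zigzag n q = zigzag n p + 2 ∨
      (zigzag n p + 2 = n ∧ zigzag n q + 1 = n)) ↔
      (p = q + 1 ∨ q = p + 1 ∨ (p = 0 ∧ q + 1 = n) ∨ (q = 0 ∧ p + 1 = n)) := by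
  unfold zigzag at *; split_ifs at * <;> omega

theorem zigzagGap_adj_iff {n i j : ℕ} (hn : 3 ≤ n) (hi : i < n) (hj : j < n) :
    ((zigzagGap n i = 0 ∧ zigzag n j = 0) ∨ zigzagGap n i = zigzag n j + 1 ∨
      zigzag n j = zigzagGap n i + 1 ∨ (zigzagGap n i + 1 = n ∧ zigzag n j + 1 = n)) ↔
      (j = i ∨ j = (i + 1) % n) := by
  have h1 := zigzag_spec n j
  have h2 := zigzagGap_spec n i
  generalize zigzag n j = a at *
  generalize zigzagGap n i = b at *
  rcases (Nat.succ_le_of_lt hi).lt_or_eq with h | h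
  · rw [Nat.mod_eq_of_lt h]
    rcases h1 with h1 | h1 | h1 <;> rcases h2 with h2 | h2 <;> omega
  · have : (i + 1) % n = 0 := by rw [← Nat.succ_eq_add_one, h, Nat.mod_self]
    rw [this]
    rcases h1 with h1 | h1 | h1 <;> rcases h2 with h2 | h2 <;> omega

theorem fin_val_sub_eq_one_iff {n : ℕ} (hn : 3 ≤ n) (u v : Fin n) :
    (u - v).val = 1 ↔ (u : ℕ) = v + 1 ∨ ((u : ℕ) = 0 ∧ (v : ℕ) + 1 = n) := by
  have hu := u.isLt
  have hv := v.isLt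
  rw [Fin.sub_def]
  by_cases h : (u : ℕ) < v
  · have := Nat.mod_eq_of_lt (show n - (v : ℕ) + u < n by omega)
    simp only [this]; omega
  · have := Nat.mod_eq_of_lt (show n - (v : ℕ) + u - n < n by omega)
    rw [← Nat.mod_eq_sub_mod (by omega)] at this
    simp only [this]; omega

variable {V : Type u} {G : SimpleGraph V}

theorem isIndContained_cycleGraph_of_zigzag {n : ℕ} (hn : 3 ≤ n) (x : ℕ → V)
    (hinj : ∀ i j, i < j → j < n → x i ≠ x j)
    (hx : ∀ i j, i < j → j < n →
      (G.Adj (x i) (x j) ↔ (i = 0 ∧ j = 1) ∨ j = i + 2 ∨ (i + 2 = n ∧ j + 1 = n))) :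
    (cycleGraph n).IsIndContained G := by
  have hinj' : ∀ i j, i < n → j < n → x i = x j → i = j := by
    intro i j hi hj h
    rcases lt_trichotomy i j with h1 | h1 | h1
    · exact absurd h (hinj i j h1 hj)
    · exact h1
    · exact absurd h.symm (hinj j i h1 hi)
  refine ⟨⟨⟨fun p => x (zigzag n p), ?_⟩, ?_⟩⟩
  · intro p q h
    exact Fin.ext (zigzag_inj p.2 q.2 (hinj' _ _ (zigzag_lt p.2) (zigzag_lt q.2) h))
  · intro p q
    change G.Adj (x (zigzag n p)) (x (zigzag n q)) ↔ _
    rw [cycleGraph_adj', fin_val_sub_eq_one_iff hn, fin_val_sub_eq_one_iff hn]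
    rcases lt_trichotomy (zigzag n p) (zigzag n q) with h | h | h
    · rw [hx _ _ h (zigzag_lt q.2), zigzag_adj_iff hn p.2 q.2 h]; omega
    · have hpq := zigzag_inj p.2 q.2 h
      rw [h]
      exact iff_of_false G.irrefl (by omega)
    · rw [G.adj_comm, hx _ _ h (zigzag_lt p.2), zigzag_adj_iff hn q.2 p.2 h]; omega

/-- The pattern between the rows `r` and the columns `c` is a cycle of length `2 * n` that runs
outwards from the corner `(0, 0)` along both off-diagonals and closes at the opposite corner.
Reading it in cyclic order gives the sun. -/
theorem isIndContained_sunGraph_of_zigzag {n : ℕ} (hn : 3 ≤ n) (r c : ℕ → V)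
    (hc : ∀ i j, i < j → j < n → G.Adj (c i) (c j))
    (hr : ∀ i j, i < j → j < n → ¬ G.ClosedAdj (r i) (r j))
    (hrc : ∀ i j, i < n → j < n → (G.ClosedAdj (r i) (c j) ↔
      (i = 0 ∧ j = 0) ∨ i = j + 1 ∨ j = i + 1 ∨ (i + 1 = n ∧ j + 1 = n))) :
    (sunGraph n).IsIndContained G := by
  have hc' : ∀ i j, i < n → j < n → (G.Adj (c i) (c j) ↔ i ≠ j) := by
    intro i j hi hj
    constructor
    · rintro h rfl; exact G.irrefl h
    · intro h
      rcases h.lt_or_gt with h | h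
      · exact hc _ _ h hj
      · exact (hc _ _ h hi).symm
  have hr' : ∀ i j, i < n → j < n → G.ClosedAdj (r i) (r j) → i = j := by
    intro i j hi hj h
    rcases lt_trichotomy i j with h1 | h1 | h1
    · exact absurd h (hr i j h1 hj)
    · exact h1
    · exact absurd h.symm (hr j i h1 hi)
  have hne : ∀ i j, i < n → j < n → r i ≠ c j := by
    intro i j hi hj h
    -- A row equal to a column would meet every column of the clique, but each row meets only two of
    -- the at least three columns.
    have hall : ∀ l, l < n → G.ClosedAdj (r i) (c l) := by
      intro l hl
      rw [h]
      by_cases hjl : j = l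
      · exact Or.inl (by rw [hjl])
      · exact Or.inr ((hc' j l hj hl).2 hjl)
    by_cases h0 : i = 0
    · have := (hrc i 2 hi (by omega)).1 (hall 2 (by omega)); omega
    · by_cases h1 : i + 1 = n
      · have := (hrc i 0 hi (by omega)).1 (hall 0 (by omega)); omega
      · have := (hrc i i hi hi).1 (hall i hi); omega
  have hadj : ∀ i j : Fin n, G.Adj (c (zigzag n j)) (r (zigzagGap n i)) ↔
      ((j : ℕ) = i ∨ (j : ℕ) = (i + 1) % n) := by
    intro i j
    rw [← zigzagGap_adj_iff hn i.2 j.2, ← hrc _ _ (zigzagGap_lt i.2) (zigzag_lt j.2), G.adj_comm]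
    simp only [ClosedAdj, hne _ _ (zigzagGap_lt i.2) (zigzag_lt j.2), false_or]
  refine ⟨⟨⟨Sum.elim (fun p => c (zigzag n p)) (fun p => r (zigzagGap n p)), ?_⟩, ?_⟩⟩
  · rintro (p | p) (q | q) h
    · simp only [Sum.elim_inl] at h
      by_contra hpq
      have := (hc' _ _ (zigzag_lt p.2) (zigzag_lt q.2)).2
        (fun h' => hpq (by rw [Fin.ext (zigzag_inj p.2 q.2 h')]))
      rw [h] at this
      exact G.irrefl this
    · exact absurd h.symm (hne _ _ (zigzagGap_lt q.2) (zigzag_lt p.2))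
    · exact absurd h (hne _ _ (zigzagGap_lt p.2) (zigzag_lt q.2))
    · rw [Fin.ext (zigzagGap_inj p.2 q.2
        (hr' _ _ (zigzagGap_lt p.2) (zigzagGap_lt q.2) (Or.inl h)))]
  · rintro (p | p) (q | q)
    · change G.Adj (c (zigzag n p)) (c (zigzag n q)) ↔ p ≠ q
      rw [hc' _ _ (zigzag_lt p.2) (zigzag_lt q.2), not_iff_not]
      exact ⟨fun h => Fin.ext (zigzag_inj p.2 q.2 h), fun h => by rw [h]⟩
    · exact hadj q p
    · rw [G.adj_comm, (sunGraph n).adj_comm]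
      exact hadj p q
    · change G.Adj (r (zigzagGap n p)) (r (zigzagGap n q)) ↔ False
      rw [iff_false]
      intro h
      have := hr' _ _ (zigzagGap_lt p.2) (zigzagGap_lt q.2) (Or.inr h)
      rw [this] at h
      exact G.irrefl h

/-! ### Perfect elimination from excluding induced cycles -/

/-- The later neighbours of every vertex form a clique. -/
def IsPerfectElimination [LinearOrder V] (G : SimpleGraph V) : Prop :=
  ∀ v u t : V, v < u → u < t → G.Adj v u → G.Adj v t → G.Adj u t

theorem IsPerfectElimination.adj [LinearOrder V] (h : G.IsPerfectElimination) {v u t : V}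
    (hvu : v < u) (hvt : v < t) (hut : u ≠ t) (h1 : G.ClosedAdj v u) (h2 : G.ClosedAdj v t) :
    G.Adj u t := by
  have h1' := h1.resolve_left hvu.ne
  have h2' := h2.resolve_left hvt.ne
  rcases hut.lt_or_gt with hlt | hlt
  · exact h v u t hvu hlt h1' h2'
  · exact (h v t u hvt hlt h2' h1').symm

theorem IsDoublyLexical.exists_max [LinearOrder V] [Finite V] (hL : G.IsDoublyLexical) {u w k : V}
    (huw : u < w) (hu : G.ClosedAdj u k) (hw : ¬ G.ClosedAdj w k) :
    ∃ y, k < y ∧ G.ClosedAdj w y ∧ ¬ G.ClosedAdj u y ∧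
      ∀ z, y < z → G.ClosedAdj w z → G.ClosedAdj u z := by
  obtain ⟨y, hy, hmax⟩ := Set.exists_max_image
    {y | k < y ∧ G.ClosedAdj w y ∧ ¬ G.ClosedAdj u y} id (Set.toFinite _) (hL u w k huw hu hw)
  refine ⟨y, hy.1, hy.2.1, hy.2.2, fun z hz hwz => ?_⟩
  by_contra huz
  exact absurd (hmax z ⟨hy.1.trans hz, hwz, huz⟩) (not_le.2 hz)

/-- If `x i` saw `y` while `x (i + 1)` did not, double lexicality would give a vertex beyond `y`
seen by `x (i + 1)` only, against `hmax`. Non-adjacency to `y` thus passes down the sequence. -/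
theorem IsDoublyLexical.not_closedAdj_of_le [LinearOrder V] (hL : G.IsDoublyLexical) (x : ℕ → V)
    {N : ℕ} {y : V} (hmono : ∀ i, i < N → x i < x (i + 1))
    (hmax : ∀ i, i < N → ∀ k, y < k → G.ClosedAdj (x (i + 1)) k → G.ClosedAdj (x i) k)
    (hN : ¬ G.ClosedAdj (x N) y) : ∀ i, i ≤ N → ¬ G.ClosedAdj (x i) y := by
  intro i hi
  induction hi using Nat.decreasingInduction with
  | self => exact hN
  | of_succ i hi ih =>
    intro h
    obtain ⟨k, hk, h1, h2⟩ := hL _ _ _ (hmono i hi) h ih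
    exact h2 (hmax i hi k hk h1)

theorem false_of_forall_strictMono [LinearOrder V] [Finite V]
    (h : ∀ m : ℕ, ∃ x : ℕ → V, ∀ i j, i < j → j ≤ m → x i < x j) : False := by
  have := Fintype.ofFinite V
  obtain ⟨x, hx⟩ := h (Fintype.card V)
  have hinj : Function.Injective (fun i : Fin (Fintype.card V + 1) => x i) := by
    intro i j hij
    have hij' : x i = x j := hij
    rcases lt_trichotomy i j with h1 | h1 | h1
    · exact absurd hij' (hx i j h1 (by omega)).ne
    · exact h1
    · exact absurd hij'.symm (hx j i h1 (by omega)).ne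
  have := Fintype.card_le_of_injective _ hinj
  simp at this

/-- A violation `v, u, t` starts an induced path growing alternately at its two ends, with
increasing labels: `x 0` is adjacent to `x 1`, and `x i` to `x (i + 2)`. The third invariant, that
each new vertex was chosen largest, keeps later vertices away from the interior. -/
theorem IsDoublyLexical.isPerfectElimination [LinearOrder V] [Finite V] (hL : G.IsDoublyLexical)
    (hG : ∀ p : ℕ, 4 ≤ p → ¬ (cycleGraph p).IsIndContained G) : G.IsPerfectElimination := by
  intro v u t hvu hut hvu' hvt'
  by_contra hut'
  have key : ∀ m : ℕ, ∃ x : ℕ → V, (∀ i j, i < j → j ≤ m + 2 → x i < x j) ∧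
      (∀ i j, i < j → j ≤ m + 2 → (G.Adj (x i) (x j) ↔ (i = 0 ∧ j = 1) ∨ j = i + 2)) ∧
      (∀ i, i + 3 ≤ m + 2 → ∀ k, x (i + 3) < k →
        G.ClosedAdj (x (i + 1)) k → G.ClosedAdj (x i) k) := by
    intro m
    induction m with
    | zero =>
      refine ⟨fun i => if i = 0 then v else if i = 1 then u else t, ?_, ?_, ?_⟩
      · intro i j hij hj
        obtain ⟨rfl, rfl⟩ | ⟨rfl, rfl⟩ | ⟨rfl, rfl⟩ :
            (i = 0 ∧ j = 1) ∨ (i = 0 ∧ j = 2) ∨ (i = 1 ∧ j = 2) := by omega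
        · simpa using hvu
        · simpa using hvu.trans hut
        · simpa using hut
      · intro i j hij hj
        obtain ⟨rfl, rfl⟩ | ⟨rfl, rfl⟩ | ⟨rfl, rfl⟩ :
            (i = 0 ∧ j = 1) ∨ (i = 0 ∧ j = 2) ∨ (i = 1 ∧ j = 2) := by omega
        · simpa using hvu'
        · simpa using hvt'
        · simpa using hut'
      · intro i hi; omega
    | succ m ih =>
      obtain ⟨x, hmono, hadj, hmax⟩ := ih
      have hnot : ¬ G.ClosedAdj (x (m + 1)) (x (m + 2)) := by
        rintro (h | h)
        · exact (hmono (m + 1) (m + 2) (by omega) le_rfl).ne h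
        · have := (hadj (m + 1) (m + 2) (by omega) le_rfl).1 h; omega
      obtain ⟨y, hy, hy1, hy2, hymax⟩ := hL.exists_max (hmono m (m + 1) (by omega) (by omega))
        (Or.inr ((hadj m (m + 2) (by omega) le_rfl).2 (by omega))) hnot
      have hlt : ∀ i, i ≤ m + 2 → x i < y := by
        intro i hi
        rcases hi.lt_or_eq with h | rfl
        · exact (hmono _ _ h le_rfl).trans hy
        · exact hy
      have hfar := hL.not_closedAdj_of_le x (N := m) (y := y)
        (fun i hi => hmono _ _ (by omega) (by omega))
        (fun i hi k hk => hmax i (by omega) k ((hlt _ (by omega)).trans hk)) hy2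
      let x' : ℕ → V := fun i => if i ≤ m + 2 then x i else y
      have hx' : ∀ i, i ≤ m + 2 → x' i = x i := fun i hi => if_pos hi
      have hxy : x' (m + 3) = y := if_neg (by omega)
      have hmono' : ∀ i j, i < j → j ≤ m + 1 + 2 → x' i < x' j := by
        intro i j hij hj
        rcases hj.lt_or_eq with h | rfl
        · rw [hx' i (by omega), hx' j (by omega)]; exact hmono i j hij (by omega)
        · rw [hx' i (by omega), show m + 1 + 2 = m + 3 by rfl, hxy]; exact hlt i (by omega)
      have hadj' : ∀ i j, i < j → j ≤ m + 3 → (G.Adj (x' i) (x' j) ↔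
          (i = 0 ∧ j = 1) ∨ j = i + 2 ∨ (i = m + 2 ∧ j = m + 3 ∧ G.Adj (x (m + 2)) y)) := by
        intro i j hij hj
        rcases hj.lt_or_eq with h | rfl
        · rw [hx' i (by omega), hx' j (by omega), hadj i j hij (by omega)]; omega
        · rw [hx' i (by omega), hxy]
          obtain h | rfl | rfl : i ≤ m ∨ i = m + 1 ∨ i = m + 2 := by omega
          · have := hfar i h
            constructor
            · exact fun h' => absurd (Or.inr h') this
            · omega
          · exact iff_of_true (hy1.resolve_left (hlt _ (by omega)).ne) (Or.inr (Or.inl rfl))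
          · simp
      -- The new vertex `y` continues the end `x (m + 1)`. Either it also meets the other end and
      -- closes an induced cycle on `m + 4` vertices, or the path has become longer.
      by_cases hclose : G.Adj (x (m + 2)) y
      · exfalso
        refine hG (m + 4) (by omega) (isIndContained_cycleGraph_of_zigzag (by omega) x'
          (fun i j hij hj => (hmono' i j hij (by omega)).ne) fun i j hij hj => ?_)
        rw [hadj' i j hij (by omega)]
        simp only [hclose, and_true]
        omega
      · refine ⟨x', hmono', fun i j hij hj => ?_, fun i hi k hk => ?_⟩
        · rw [hadj' i j hij (by omega)]
          simp only [hclose, and_false, or_false]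
        · rw [hx' i (by omega), hx' (i + 1) (by omega)]
          rcases hi.lt_or_eq with h | h
          · rw [hx' _ (by omega)] at hk
            exact hmax i (by omega) k hk
          · obtain rfl : i = m := by omega
            rw [hxy] at hk
            exact hymax k hk
  exact false_of_forall_strictMono fun m =>
    (key m).imp fun x hx i j hij hj => hx.1 i j hij (by omega)

end SimpleGraph

/-! ### Strong elimination from excluding suns -/

namespace SimpleGraph
variable {V : Type u} {G : SimpleGraph V}

/-- If `v < v'` are earlier neighbours of `u`, then every neighbour of `v` after `u` is a
neighbour of `v'`. -/
def IsStrongElimination [LinearOrder V] (G : SimpleGraph V) : Prop :=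
  ∀ v v' u t : V, v < v' → v' < u → u < t → G.Adj v u → G.Adj v t → G.Adj v' u → G.Adj v' t

theorem IsPerfectElimination.lt_of_not_closedAdj [LinearOrder V] (hP : G.IsPerfectElimination)
    {r c c' : V} (hcc : G.Adj c c') (hlt : c < c') (h : G.ClosedAdj r c)
    (h' : ¬ G.ClosedAdj r c') : r < c := by
  rcases lt_trichotomy r c with h1 | rfl | h1
  · exact h1
  · exact absurd (Or.inr hcc) h'
  · exact absurd (Or.inr (hP.adj h1 hlt (fun e => h' (Or.inl e)) h.symm (Or.inr hcc))) h'

theorem IsPerfectElimination.not_closedAdj [LinearOrder V] (hP : G.IsPerfectElimination)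
    {r s c : V} (hrs : r < s) (hrc : r < c) (h : G.ClosedAdj r c) (h' : ¬ G.ClosedAdj s c) :
    ¬ G.ClosedAdj r s := fun hrs' =>
  h' (Or.inr (hP.adj hrs hrc (fun e => h' (Or.inl e)) hrs' h))

/-- For two rows there is a column later than the first, met by the first and missed by the second;
adjacent rows would then contradict perfect elimination. The corner `(K, K)` is left unspecified
because it is `0` while the zigzag grows and `1` when it closes; `2 ≤ K` keeps it apart from the
entry `(1, 1)`. -/
theorem IsPerfectElimination.not_closedAdj_of_zigzag [LinearOrder V]
    (hP : G.IsPerfectElimination) (r c : ℕ → V) {K : ℕ} (hK : 2 ≤ K)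
    (hr : ∀ i j, i < j → j ≤ K → r i < r j) (hc : ∀ i j, i < j → j ≤ K → c i < c j)
    (hcc : ∀ i j, i < j → j ≤ K → G.Adj (c i) (c j)) (h0 : r 0 < c 0)
    (hrc : ∀ i j, i ≤ K → j ≤ K → i + j < 2 * K → (G.ClosedAdj (r i) (c j) ↔
      (i = 0 ∧ j = 0) ∨ i = j + 1 ∨ j = i + 1)) :
    ∀ i j, i < j → j ≤ K → ¬ G.ClosedAdj (r i) (r j) := by
  intro i j hij hj
  have hrij := hr i j hij hj
  rcases i with _ | i
  · obtain rfl | h : j = 1 ∨ 2 ≤ j := by omega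
    · refine hP.not_closedAdj (c := c 1) hrij (h0.trans (hc 0 1 (by omega) hj)) ?_ ?_ <;>
      · rw [hrc _ _ (by omega) (by omega) (by omega)]; omega
    · refine hP.not_closedAdj (c := c 0) hrij h0 ?_ ?_ <;>
      · rw [hrc _ _ (by omega) (by omega) (by omega)]; omega
  · have hlt : r (i + 1) < c i := by
      refine hP.lt_of_not_closedAdj (hcc i (i + 1) (by omega) (by omega))
        (hc i (i + 1) (by omega) (by omega)) ?_ ?_ <;>
      · rw [hrc _ _ (by omega) (by omega) (by omega)]; omega
    refine hP.not_closedAdj hrij hlt ?_ ?_ <;>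
    · rw [hrc _ _ (by omega) (by omega) (by omega)]; omega

/-- A zigzag configuration of rows `r` and columns `c` of the closed neighbourhood matrix. -/
structure IsZigzag [LinearOrder V] (G : SimpleGraph V) (m : ℕ) (r c : ℕ → V) : Prop where
  row_lt : ∀ i j, i < j → j ≤ m → r i < r j
  col_lt : ∀ i j, i < j → j ≤ m → c i < c j
  clique : ∀ i j, i < j → j ≤ m → G.Adj (c i) (c j)
  zero_lt : r 0 < c 0
  adj_iff : ∀ i j, i ≤ m → j ≤ m → (G.ClosedAdj (r i) (c j) ↔
    (i = 0 ∧ j = 0) ∨ i = j + 1 ∨ j = i + 1)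
  max_col : ∀ i, i + 2 ≤ m → ∀ k, c (i + 2) < k → G.ClosedAdj (r (i + 1)) k → G.ClosedAdj (r i) k
  max_row : ∀ i, i + 2 ≤ m → ∀ k, r (i + 2) < k → G.ClosedAdj (c (i + 1)) k → G.ClosedAdj (c i) k

/-- Perfect elimination joins `y` to the last two columns. Going down, let `c i` be the first column
missed. Then all earlier columns miss `y` too, since otherwise `c i` and `y` would be later
neighbours of a common vertex, and `y` becomes the row that closes a smaller sun. -/
theorem IsZigzag.adj_col [LinearOrder V] (hP : G.IsPerfectElimination)
    (hG : ∀ n : ℕ, 3 ≤ n → ¬ (sunGraph n).IsIndContained G) {m : ℕ} {r c : ℕ → V}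
    (h : G.IsZigzag (m + 1) r c) {y : V} (hy : c (m + 1) < y) (hry : G.ClosedAdj (r (m + 1)) y)
    (hfar : ∀ i, i ≤ m → ¬ G.ClosedAdj (r i) y) : ∀ j, j ≤ m + 1 → G.Adj (c j) y := by
  have hcy : ∀ j, j ≤ m + 1 → c j < y := by
    intro j hj
    rcases hj.lt_or_eq with h' | rfl
    · exact (h.col_lt _ _ h' le_rfl).trans hy
    · exact hy
  have hlt : r (m + 1) < c m := by
    refine hP.lt_of_not_closedAdj (h.clique m (m + 1) (by omega) (by omega))
      (h.col_lt m (m + 1) (by omega) (by omega)) ?_ ?_ <;>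
    · rw [h.adj_iff _ _ (by omega) (by omega)]; omega
  have hm : G.Adj (c m) y := hP.adj hlt (hlt.trans (hcy m (by omega))) (hcy m (by omega)).ne
    ((h.adj_iff _ _ le_rfl (by omega)).2 (by omega)) hry
  have hm1 : G.Adj (c (m + 1)) y := hP.adj (h.col_lt m (m + 1) (by omega) le_rfl)
    (hcy m (by omega)) hy.ne (Or.inr (h.clique m (m + 1) (by omega) le_rfl)) (Or.inr hm)
  have key : ∀ d, ∀ j, j ≤ m + 1 → m ≤ j + d → G.Adj (c j) y := by
    intro d
    induction d with
    | zero =>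
      intro j hj hmj
      obtain rfl | rfl : j = m ∨ j = m + 1 := by omega
      · exact hm
      · exact hm1
    | succ d ih =>
      intro i hi hmi
      by_cases hmi' : m ≤ i + d
      · exact ih i hi hmi'
      by_contra hcon
      have hdown : ∀ j, j ≤ i → ¬ G.ClosedAdj (c j) y := by
        intro j hj hadj
        rcases hj.lt_or_eq with h' | rfl
        · exact hcon (hP.adj (h.col_lt j i h' hi) (hcy j (by omega)) (hcy i hi).ne
            (Or.inr (h.clique j i h' hi)) hadj)
        · exact hcon (hadj.resolve_left (hcy j hi).ne)
      have hup : ∀ j, i < j → j ≤ m + 1 → G.Adj (c j) y := fun j hj hj' => ih j hj' (by omega)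
      let r' : ℕ → V := fun j => if j ≤ i + 1 then r j else y
      have hr' : ∀ j, j ≤ i + 1 → r' j = r j := fun j hj => if_pos hj
      have hry' : r' (i + 2) = y := if_neg (by omega)
      -- The rows `r 0, …, r (i + 1), y` and columns `c 0, …, c (i + 2)` form the sun: among these
      -- columns, `y` meets exactly the last two.
      refine hG (i + 3) (by omega) (isIndContained_sunGraph_of_zigzag (by omega) r' c
        (fun j k hjk hk => h.clique j k hjk (by omega)) ?_ ?_)
      · intro j k hjk hk
        rcases (Nat.lt_succ_iff.1 hk).lt_or_eq with h' | rfl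
        · rw [hr' j (by omega), hr' k (by omega)]
          exact hP.not_closedAdj_of_zigzag r c (K := m + 1) (by omega) h.row_lt h.col_lt h.clique
            h.zero_lt (fun i j hi hj _ => h.adj_iff i j hi hj) j k hjk (by omega)
        · rw [hr' j (by omega), hry']
          exact hfar j (by omega)
      · intro j k hj hk
        rcases (Nat.lt_succ_iff.1 hj).lt_or_eq with h' | rfl
        · rw [hr' j (by omega), h.adj_iff j k (by omega) (by omega)]; omega
        · rw [hry', closedAdj_comm]
          by_cases hki : k ≤ i
          · exact iff_of_false (hdown k hki) (by omega)
          · exact iff_of_true (Or.inr (hup k (by omega) (by omega))) (by omega)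
  exact fun j hj => key m j hj (by omega)

/-- A violation is a block with rows `v, v'`, columns `u, t` and a single zero, at `(v', t)`. As the
matrix is symmetric, the extremal choice that supplies a new column also supplies a new row, so the
zigzag grows in both directions at once. -/
theorem IsDoublyLexical.isStrongElimination [LinearOrder V] [Finite V] (hL : G.IsDoublyLexical)
    (hP : G.IsPerfectElimination) (hG : ∀ n : ℕ, 3 ≤ n → ¬ (sunGraph n).IsIndContained G) :
    G.IsStrongElimination := by
  intro v v' u t hvv' hv'u hut hvu hvt hv'uadj
  by_contra hv't
  have key : ∀ m : ℕ, ∃ r c : ℕ → V, G.IsZigzag (m + 1) r c := by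
    intro m
    induction m with
    | zero =>
      refine ⟨fun i => if i = 0 then v else v', fun i => if i = 0 then u else t, ?_⟩
      have h01 : ∀ i j, i < j → j ≤ 0 + 1 → i = 0 ∧ j = 1 := by omega
      refine ⟨?_, ?_, ?_, ?_, ?_, by omega, by omega⟩
      · intro i j hij hj
        obtain ⟨rfl, rfl⟩ := h01 i j hij hj
        simpa using hvv'
      · intro i j hij hj
        obtain ⟨rfl, rfl⟩ := h01 i j hij hj
        simpa using hut
      · intro i j hij hj
        obtain ⟨rfl, rfl⟩ := h01 i j hij hj
        simpa using hP v u t (hvv'.trans hv'u) hut hvu hvt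
      · simpa using hvv'.trans hv'u
      · intro i j hi hj
        obtain ⟨rfl | rfl, rfl | rfl⟩ : (i = 0 ∨ i = 1) ∧ (j = 0 ∨ j = 1) := by omega
        · simpa [ClosedAdj] using Or.inr hvu
        · simpa [ClosedAdj] using Or.inr hvt
        · simpa [ClosedAdj] using Or.inr hv'uadj
        · simpa [ClosedAdj, hv't] using (hv'u.trans hut).ne
    | succ m ih =>
      obtain ⟨r, c, h⟩ := ih
      have hnot : ¬ G.ClosedAdj (r (m + 1)) (c (m + 1)) := by
        rw [h.adj_iff _ _ le_rfl le_rfl]; omega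
      obtain ⟨y, hy, hy1, hy2, hymax⟩ := hL.exists_max (h.row_lt m (m + 1) (by omega) le_rfl)
        ((h.adj_iff m (m + 1) (by omega) le_rfl).2 (by omega)) hnot
      obtain ⟨z, hz, hz1, hz2, hzmax⟩ := hL.exists_max (h.col_lt m (m + 1) (by omega) le_rfl)
        (((h.adj_iff (m + 1) m le_rfl (by omega)).2 (by omega)).symm) (fun h' => hnot h'.symm)
      have hlty : ∀ i, i ≤ m + 1 → c i < y := by
        intro i hi
        rcases hi.lt_or_eq with h' | rfl
        · exact (h.col_lt _ _ h' le_rfl).trans hy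
        · exact hy
      have hltz : ∀ i, i ≤ m + 1 → r i < z := by
        intro i hi
        rcases hi.lt_or_eq with h' | rfl
        · exact (h.row_lt _ _ h' le_rfl).trans hz
        · exact hz
      have hfary := hL.not_closedAdj_of_le r (N := m) (y := y)
        (fun i hi => h.row_lt _ _ (by omega) (by omega))
        (fun i hi k hk => h.max_col i (by omega) k ((hlty _ (by omega)).trans hk)) hy2
      have hfarz := hL.not_closedAdj_of_le c (N := m) (y := z)
        (fun i hi => h.col_lt _ _ (by omega) (by omega))
        (fun i hi k hk => h.max_row i (by omega) k ((hltz _ (by omega)).trans hk)) hz2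
      have hcol := h.adj_col hP hG hy hy1 hfary
      let r' : ℕ → V := fun i => if i ≤ m + 1 then r i else z
      have hr' : ∀ i, i ≤ m + 1 → r' i = r i := fun i hi => if_pos hi
      have hrz : r' (m + 2) = z := if_neg (by omega)
      let c' : ℕ → V := fun i => if i ≤ m + 1 then c i else y
      have hc' : ∀ i, i ≤ m + 1 → c' i = c i := fun i hi => if_pos hi
      have hcy : c' (m + 2) = y := if_neg (by omega)
      have hrow_lt : ∀ i j, i < j → j ≤ m + 2 → r' i < r' j := by
        intro i j hij hj
        rcases hj.lt_or_eq with h' | rfl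
        · rw [hr' i (by omega), hr' j (by omega)]; exact h.row_lt i j hij (by omega)
        · rw [hr' i (by omega), hrz]; exact hltz i (by omega)
      have hcol_lt : ∀ i j, i < j → j ≤ m + 2 → c' i < c' j := by
        intro i j hij hj
        rcases hj.lt_or_eq with h' | rfl
        · rw [hc' i (by omega), hc' j (by omega)]; exact h.col_lt i j hij (by omega)
        · rw [hc' i (by omega), hcy]; exact hlty i (by omega)
      have hclique : ∀ i j, i < j → j ≤ m + 2 → G.Adj (c' i) (c' j) := by
        intro i j hij hj
        rcases hj.lt_or_eq with h' | rfl
        · rw [hc' i (by omega), hc' j (by omega)]; exact h.clique i j hij (by omega)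
        · rw [hc' i (by omega), hcy]; exact hcol i (by omega)
      have hzero : r' 0 < c' 0 := by
        rw [hr' 0 (by omega), hc' 0 (by omega)]; exact h.zero_lt
      have hadj : ∀ i j, i ≤ m + 2 → j ≤ m + 2 → i + j < 2 * (m + 2) →
          (G.ClosedAdj (r' i) (c' j) ↔ (i = 0 ∧ j = 0) ∨ i = j + 1 ∨ j = i + 1) := by
        intro i j hi hj hij
        rcases hi.lt_or_eq with hi' | rfl
        · rw [hr' i (by omega)]
          rcases hj.lt_or_eq with hj' | rfl
          · rw [hc' j (by omega)]
            exact h.adj_iff i j (by omega) (by omega)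
          · rw [hcy]
            obtain h' | rfl : i ≤ m ∨ i = m + 1 := by omega
            · exact iff_of_false (hfary i h') (by omega)
            · exact iff_of_true hy1 (by omega)
        · rw [hrz, hc' j (by omega), closedAdj_comm]
          obtain h' | rfl : j ≤ m ∨ j = m + 1 := by omega
          · exact iff_of_false (hfarz j h') (by omega)
          · exact iff_of_true hz1 (by omega)
      -- The new corner entry decides: `1` closes a sun on `m + 3` rows and columns, `0` gives a
      -- longer zigzag.
      by_cases hclose : G.ClosedAdj z y
      · exfalso
        refine hG (m + 3) (by omega) (isIndContained_sunGraph_of_zigzag (by omega) r' c'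
          (fun j k hjk hk => hclique j k hjk (by omega))
          (fun j k hjk hk => hP.not_closedAdj_of_zigzag r' c' (K := m + 2) (by omega) hrow_lt
            hcol_lt hclique hzero hadj j k hjk (by omega)) ?_)
        intro i j hi hj
        by_cases hij : i + j < 2 * (m + 2)
        · rw [hadj i j (by omega) (by omega) hij]; omega
        · obtain ⟨rfl, rfl⟩ : i = m + 2 ∧ j = m + 2 := by omega
          rw [hrz, hcy]
          exact iff_of_true hclose (by omega)
      · refine ⟨r', c', hrow_lt, hcol_lt, hclique, hzero, ?_, ?_, ?_⟩
        · intro i j hi hj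
          by_cases hij : i + j < 2 * (m + 2)
          · exact hadj i j (by omega) (by omega) hij
          · obtain ⟨rfl, rfl⟩ : i = m + 2 ∧ j = m + 2 := by omega
            rw [hrz, hcy]
            exact iff_of_false hclose (by omega)
        · intro i hi k hk
          rw [hr' i (by omega), hr' (i + 1) (by omega)]
          rcases hi.lt_or_eq with h' | h'
          · rw [hc' _ (by omega)] at hk
            exact h.max_col i (by omega) k hk
          · obtain rfl : i = m := by omega
            rw [hcy] at hk
            exact hymax k hk
        · intro i hi k hk
          rw [hc' i (by omega), hc' (i + 1) (by omega)]
          rcases hi.lt_or_eq with h' | h'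
          · rw [hr' _ (by omega)] at hk
            exact h.max_row i (by omega) k hk
          · obtain rfl : i = m := by omega
            rw [hrz] at hk
            exact hzmax k hk
  refine false_of_forall_strictMono (V := V) fun m => ?_
  obtain ⟨r, c, h⟩ := key m
  exact ⟨r, fun i j hij hj => h.row_lt i j hij (by omega)⟩

end SimpleGraph

/-! ### Construction of the chain system -/

/-- The conditions at `u` for a system `C` of chains of sets, `C u` consisting of sets of elements
above `u`: the chain `C u` is saturated, and each of its non-empty members has the form
`insert w B'` with `B' ∈ C w`. -/
structure IsSaturatedAt {V : Type u} [LinearOrder V] (C : V → Set (Finset V)) (u : V) : Prop where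
  lt_of_mem : ∀ B ∈ C u, ∀ x ∈ B, u < x
  total : ∀ B ∈ C u, ∀ B' ∈ C u, B ⊆ B' ∨ B' ⊆ B
  empty_mem : ∅ ∈ C u
  tail_mem : ∀ B ∈ C u, B.Nonempty → ∃ w, ∃ B' ∈ C w, B = insert w B'
  exists_pred : ∀ B ∈ C u, B.Nonempty → ∃ B' ∈ C u, B' ⊆ B ∧ B'.card + 1 = B.card

/-- Two nested members of the family are linked by a member of one element less than the larger. -/
theorem IsSaturatedAt.exists_between {V : Type u} [LinearOrder V] {C : V → Set (Finset V)} {w : V}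
    (hw : IsSaturatedAt C w) {B₁ A : Finset V} (hB₁ : B₁ ∈ C w)
    (hA : A = ∅ ∨ ∃ w', ∃ B ∈ C w', (∀ x ∈ B, w' < x) ∧ A = insert w' B)
    (hss : A ⊂ insert w B₁) :
    ∃ D : Finset V, (D = ∅ ∨ ∃ w', ∃ B ∈ C w', D = insert w' B) ∧ A ⊆ D ∧ D ⊆ insert w B₁ ∧
      D.card + 1 = (insert w B₁).card := by
  have hwB : w ∉ B₁ := fun h => lt_irrefl _ (hw.lt_of_mem B₁ hB₁ w h)
  by_cases hwA : w ∈ A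
  · rcases hA with rfl | ⟨w', B, hB, hlt, rfl⟩
    · simp at hwA
    -- Both are the least element of their set, and `w` lies in `A ⊆ insert w B₁`. So `B` and `B₁`
    -- are in the same chain, and the predecessor of `B₁` there yields the required set.
    have hww : w' = w := by
      rcases Finset.mem_insert.1 hwA with h | h
      · exact h.symm
      · have h1 := hlt w h
        rcases Finset.mem_insert.1 (hss.1 (Finset.mem_insert_self w' B)) with h2 | h2
        · exact h2
        · exact absurd (hw.lt_of_mem B₁ hB₁ w' h2) h1.asymm
    subst hww
    have hw'B : w' ∉ B := fun h => lt_irrefl _ (hlt w' h)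
    have hBB : B ⊂ B₁ := by
      refine ⟨(Finset.insert_subset_insert_iff hw'B).1 hss.1, fun h => hss.2 ?_⟩
      exact Finset.insert_subset_insert _ h
    obtain ⟨B₂, hB₂, hsub, hcard⟩ := hw.exists_pred B₁ hB₁
      (Finset.card_pos.1 ((Nat.zero_le _).trans_lt (Finset.card_lt_card hBB)))
    have hw'B₂ : w' ∉ B₂ := fun h => hwB (hsub h)
    refine ⟨insert w' B₂, Or.inr ⟨w', B₂, hB₂, rfl⟩, ?_, Finset.insert_subset_insert _ hsub, ?_⟩
    · refine Finset.insert_subset_insert _ ?_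
      rcases hw.total B hB B₂ hB₂ with h | h
      · exact h
      · have := Finset.card_lt_card hBB
        rw [Finset.eq_of_subset_of_card_le h (by omega)]
    · rw [Finset.card_insert_of_notMem hwB, Finset.card_insert_of_notMem hw'B₂, hcard]
  -- Here `A` misses `w`, so it already lies in the tail `B₁`.
  · refine ⟨B₁, ?_, ?_, Finset.subset_insert _ _, by rw [Finset.card_insert_of_notMem hwB]⟩
    · rcases B₁.eq_empty_or_nonempty with h | h
      · exact Or.inl h
      · exact Or.inr (hw.tail_mem B₁ hB₁ h)
    · intro x hx
      rcases Finset.mem_insert.1 (hss.1 hx) with rfl | h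
      · exact absurd hx hwA
      · exact h

namespace SimpleGraph
variable {V : Type u} [LinearOrder V]

/-- The conditions at `u` for a system of chains `C` adapted to a graph. -/
structure ChainCondition (G : SimpleGraph V) (C : V → Set (Finset V)) (u : V) : Prop where
  saturated : IsSaturatedAt C u
  adj : ∀ B ∈ C u, ∀ x ∈ B, G.Adj u x
  later_mem : ∀ v, v ≤ u → G.ClosedAdj v u → ∀ B : Finset V,
    (∀ x, x ∈ B ↔ u < x ∧ G.Adj v x) → B ∈ C u

/-- The prescribed sets `E` form a chain by strong elimination, and they are admissible (in `M`)
because removing the least element `w` from `L v` leaves the neighbours of `v` above `w`, prescribed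
for `C w`. Any maximal chain of admissible sets containing `E` has no gaps, since
`IsSaturatedAt.exists_between` would fill one. -/
theorem exists_chainCondition_insert [Fintype V] {G : SimpleGraph V}
    (hP : G.IsPerfectElimination) (hS : G.IsStrongElimination) (C : V → Set (Finset V)) (a : V)
    (hC : ∀ u, a < u → G.ChainCondition C u) :
    ∃ D : Set (Finset V), G.ChainCondition (Function.update C a D) a := by
  classical
  let L : V → Finset V := fun v => Finset.univ.filter fun x => a < x ∧ G.Adj v x
  have hL : ∀ v x, x ∈ L v ↔ a < x ∧ G.Adj v x := fun v x => by simp [L]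
  let M : Set (Finset V) := {B | (∀ x ∈ B, a < x ∧ G.Adj a x) ∧
    (B = ∅ ∨ ∃ w, ∃ B' ∈ C w, B = insert w B')}
  let E : Set (Finset V) := insert ∅ {B | ∃ v, v ≤ a ∧ G.ClosedAdj v a ∧ B = L v}
  have hLM : ∀ v, v ≤ a → G.ClosedAdj v a → L v ∈ M := by
    intro v hva hadj
    refine ⟨fun x hx => ?_, ?_⟩
    · obtain ⟨hax, hvx⟩ := (hL v x).1 hx
      refine ⟨hax, ?_⟩
      rcases hva.lt_or_eq with h | rfl
      · exact hP v a x h hax (hadj.resolve_left h.ne) hvx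
      · exact hvx
    · rcases (L v).eq_empty_or_nonempty with h | h
      · exact Or.inl h
      · right
        obtain ⟨haw, hvw⟩ := (hL v _).1 (Finset.min'_mem _ h)
        set w := (L v).min' h with hw
        refine ⟨w, (L v).erase w, ?_, (Finset.insert_erase (Finset.min'_mem _ h)).symm⟩
        refine (hC w haw).later_mem v (hva.trans haw.le) (Or.inr hvw) _ fun x => ?_
        rw [Finset.mem_erase, hL]
        constructor
        · rintro ⟨hxw, hax, hvx⟩
          exact ⟨lt_of_le_of_ne (Finset.min'_le _ _ ((hL v x).2 ⟨hax, hvx⟩)) hxw.symm, hvx⟩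
        · rintro ⟨hwx, hvx⟩
          exact ⟨hwx.ne', haw.trans hwx, hvx⟩
  have hmono : ∀ v v', v ≤ v' → v' ≤ a → G.ClosedAdj v a → G.ClosedAdj v' a → L v ⊆ L v' := by
    intro v v' hvv' hv'a h h' x hx
    obtain ⟨hax, hvx⟩ := (hL v x).1 hx
    refine (hL v' x).2 ⟨hax, ?_⟩
    rcases hvv'.lt_or_eq with hlt | rfl
    · rcases hv'a.lt_or_eq with hlt' | rfl
      · exact hS v v' a x hlt hlt' hax (h.resolve_left (hlt.trans hlt').ne) hvx
          (h'.resolve_left hlt'.ne)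
      · exact hP v v' x hlt hax (h.resolve_left hlt.ne) hvx
    · exact hvx
  have hEM : E ⊆ M := by
    rintro B (rfl | ⟨v, hva, hadj, rfl⟩)
    · exact ⟨by simp, Or.inl rfl⟩
    · exact hLM v hva hadj
  have hEchain : IsChain (· ⊆ ·) E := by
    rintro B (rfl | ⟨v, hva, hadj, rfl⟩) B' (rfl | ⟨v', hva', hadj', rfl⟩) _
    · exact Or.inl le_rfl
    · exact Or.inl (Finset.empty_subset _)
    · exact Or.inr (Finset.empty_subset _)
    · rcases le_total v v' with h | h
      · exact Or.inl (hmono v v' h hva' hadj hadj')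
      · exact Or.inr (hmono v' v h hva hadj' hadj)
  obtain ⟨D, hED, hD⟩ := Finite.exists_le_maximal
    (p := fun D : Set (Finset V) => D ⊆ M ∧ IsChain (· ⊆ ·) D) ⟨hEM, hEchain⟩
  obtain ⟨⟨hDM, hDchain⟩, hDmax⟩ := hD
  refine ⟨D, ?_⟩
  have hupd : Function.update C a D a = D := Function.update_self _ _ _
  have hne : ∀ {B : Finset V} {w : V} {B' : Finset V}, B ∈ M → B = insert w B' → a < w := by
    rintro B w B' hB rfl
    exact (hB.1 w (Finset.mem_insert_self _ _)).1
  refine ⟨⟨?_, ?_, ?_, ?_, ?_⟩, ?_, ?_⟩ <;> rw [hupd]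
  · exact fun B hB x hx => ((hDM hB).1 x hx).1
  · exact fun B hB B' hB' => hDchain.total hB hB'
  · exact hED (Or.inl rfl)
  · intro B hB hne'
    obtain ⟨w, B', hB', h⟩ := (hDM hB).2.resolve_left hne'.ne_empty
    refine ⟨w, B', ?_, h⟩
    rwa [Function.update_of_ne (hne (hDM hB) h).ne']
  · intro B hB hne'
    obtain ⟨w, B₁, hB₁, hBw⟩ := (hDM hB).2.resolve_left hne'.ne_empty
    have haw := hne (hDM hB) hBw
    -- With `A` the largest member of `D` properly inside `B`, the set `X` between them is
    -- comparable with all of `D`, hence belongs to `D` by maximality.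
    obtain ⟨A, hA, hAmax⟩ := Finset.exists_max_image
      (Finset.univ.filter fun A : Finset V => A ∈ D ∧ A ⊂ B) Finset.card
      ⟨∅, by simpa using ⟨hED (Or.inl rfl), hne'⟩⟩
    simp only [Finset.mem_filter, Finset.mem_univ, true_and] at hA hAmax
    obtain ⟨X, hX, hAX, hXB, hcard⟩ := (hC w haw).saturated.exists_between (A := A) hB₁ (by
      refine (hDM hA.1).2.imp id ?_
      rintro ⟨w', B', hB', h⟩
      exact ⟨w', B', hB', fun x hx => (hC w' (hne (hDM hA.1) h)).saturated.lt_of_mem B' hB' x hx, h⟩)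
      (hBw ▸ hA.2)
    rw [← hBw] at hXB hcard
    have hXM : X ∈ M := ⟨fun x hx => (hDM hB).1 x (hXB hx), hX⟩
    have hins : IsChain (· ⊆ ·) (insert X D) := by
      refine hDchain.insert fun Y hY _ => ?_
      rcases hDchain.total hB hY with h | h
      · exact Or.inl (hXB.trans h)
      · by_cases hYB : Y = B
        · exact Or.inl (hYB ▸ hXB)
        · have hYss : Y ⊂ B := lt_of_le_of_ne h hYB
          rcases hDchain.total hA.1 hY with h' | h'
          · rw [← Finset.eq_of_subset_of_card_le h' (hAmax Y ⟨hY, hYss⟩)]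
            exact Or.inr hAX
          · exact Or.inr (h'.trans hAX)
    exact ⟨X, hDmax ⟨Set.insert_subset hXM hDM, hins⟩ (Set.subset_insert _ _)
      (Set.mem_insert _ _), hXB, hcard⟩
  · exact fun B hB x hx => ((hDM hB).1 x hx).2
  · intro v hva hadj B hB
    have : B = L v := by ext x; rw [hB, hL]
    exact hED (Or.inr ⟨v, hva, hadj, this⟩)

theorem exists_chainCondition [Fintype V] {G : SimpleGraph V} (hP : G.IsPerfectElimination)
    (hS : G.IsStrongElimination) : ∃ C : V → Set (Finset V), ∀ u, G.ChainCondition C u := by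
  classical
  -- Chains are chosen over final segments, from the last vertex down. The conditions at `u` involve
  -- only `C u` and the chains of later vertices, so defining the chain at a new least vertex
  -- preserves them.
  suffices h : ∀ s : Finset V, (∀ x ∈ s, ∀ y, x < y → y ∈ s) →
      ∃ C : V → Set (Finset V), ∀ u ∈ s, G.ChainCondition C u by
    obtain ⟨C, hC⟩ := h Finset.univ (by simp)
    exact ⟨C, fun u => hC u (Finset.mem_univ u)⟩
  intro s
  induction s using Finset.induction_on_min with
  | empty => exact fun _ => ⟨fun _ => ∅, by simp⟩
  | insert a s has ih =>
    intro hup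
    obtain ⟨C, hC⟩ := ih fun x hx y hxy =>
      Finset.mem_of_mem_insert_of_ne (hup x (Finset.mem_insert_of_mem hx) y hxy)
        ((has x hx).trans hxy).ne'
    have hC' : ∀ u, a < u → G.ChainCondition C u := fun u hu =>
      hC u (Finset.mem_of_mem_insert_of_ne (hup a (Finset.mem_insert_self _ _) u hu) hu.ne')
    obtain ⟨D, hD⟩ := exists_chainCondition_insert hP hS C a hC'
    refine ⟨Function.update C a D, fun u hu => ?_⟩
    rcases Finset.mem_insert.1 hu with rfl | hu
    · exact hD
    have hau := has u hu
    have h := hC u hu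
    have hupd : Function.update C a D u = C u := Function.update_of_ne hau.ne' _ _
    refine ⟨⟨?_, ?_, ?_, ?_, ?_⟩, ?_, ?_⟩ <;> rw [hupd]
    · exact h.saturated.lt_of_mem
    · exact h.saturated.total
    · exact h.saturated.empty_mem
    · intro B hB hne
      obtain ⟨w, B', hB', rfl⟩ := h.saturated.tail_mem B hB hne
      have := h.saturated.lt_of_mem _ hB w (Finset.mem_insert_self _ _)
      exact ⟨w, B', by rwa [Function.update_of_ne (hau.trans this).ne'], rfl⟩
    · exact h.saturated.exists_pred
    · exact h.adj
    · exact h.later_mem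

end SimpleGraph

/-! ### Combinatorics of the set family -/

/-- The family of sets described by a system of chains. -/
def chainFamily {V : Type u} [LinearOrder V] (C : V → Set (Finset V)) : Set (Finset V) :=
  {A | ∃ w, ∃ B ∈ C w, A = insert w B}

/-- The vertex of a cycle minimising `f` would have two neighbours on the cycle with values at least
its own. -/
theorem SimpleGraph.isAcyclic_of_unique_larger {α β : Type*} [LinearOrder β] {H : SimpleGraph α}
    (f : α → β)
    (h : ∀ x y z, H.Adj x y → H.Adj x z → f x ≤ f y → f x ≤ f z → y = z) : H.IsAcyclic := by
  classical
  intro v c hc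
  obtain ⟨x, hx, hmin⟩ := Finset.exists_min_image c.support.toFinset f ⟨v, by simp⟩
  have hx' : x ∈ c.support := by simpa using hx
  obtain ⟨y, z, hyz, hset⟩ := Set.ncard_eq_two.1 (hc.ncard_neighborSet_toSubgraph_eq_two hx')
  have key : ∀ y, y ∈ c.toSubgraph.neighborSet x → H.Adj x y ∧ f x ≤ f y := by
    intro y hy
    have hadj : c.toSubgraph.Adj x y := hy
    refine ⟨hadj.adj_sub, hmin y ?_⟩
    have := c.toSubgraph.edge_vert hadj.symm
    simpa using this
  have hy := key y (by rw [hset]; simp)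
  have hz := key z (by rw [hset]; simp)
  exact hyz (h x y z hy.1 hz.1 hy.2 hz.2)

section
variable {V : Type u} [LinearOrder V] {C : V → Set (Finset V)}

theorem card_insert_of_saturated (hC : ∀ w, IsSaturatedAt C w) {w : V} {B : Finset V}
    (hB : B ∈ C w) : (insert w B).card = B.card + 1 :=
  Finset.card_insert_of_notMem fun h => lt_irrefl _ ((hC w).lt_of_mem B hB w h)

theorem mem_chainFamily_of_nonempty (hC : ∀ w, IsSaturatedAt C w) {w : V} {B : Finset V}
    (hB : B ∈ C w) (hne : B.Nonempty) : B ∈ chainFamily C := (hC w).tail_mem B hB hne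

theorem nonempty_of_mem_chainFamily {A : Finset V} (hA : A ∈ chainFamily C) : A.Nonempty := by
  obtain ⟨w, B, -, rfl⟩ := hA
  exact Finset.insert_nonempty _ _

theorem exists_between_of_ssubset (hC : ∀ w, IsSaturatedAt C w) {A A' : Finset V}
    (hA : A ∈ chainFamily C) (hA' : A' ∈ chainFamily C) (h : A ⊂ A') :
    ∃ D ∈ chainFamily C, A ⊆ D ∧ D ⊆ A' ∧ D.card + 1 = A'.card := by
  obtain ⟨w, B, hB, rfl⟩ := hA'
  have hne := nonempty_of_mem_chainFamily hA
  obtain ⟨w', B', hB', hA⟩ := hA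
  obtain ⟨D, hD, h1, h2, h3⟩ := (hC w).exists_between hB
    (Or.inr ⟨w', B', hB', (hC w').lt_of_mem B' hB', hA⟩) h
  refine ⟨D, hD.resolve_left ?_, h1, h2, h3⟩
  exact (hne.mono h1).ne_empty

theorem eq_of_card_eq (hC : ∀ w, IsSaturatedAt C w) {w : V} {B B' : Finset V}
    (hB : B ∈ C w) (hB' : B' ∈ C w) (h : B.card = B'.card) : B = B' := by
  rcases (hC w).total B hB B' hB' with h' | h'
  · exact Finset.eq_of_subset_of_card_le h' h.ge
  · exact (Finset.eq_of_subset_of_card_le h' h.le).symm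

theorem eq_insert_of_subset (hC : ∀ w, IsSaturatedAt C w) {A B : Finset V} {w : V}
    (hA : A ∈ chainFamily C) (hB : B ∈ C w) (hAB : A ⊆ insert w B) :
    A ⊆ B ∨ ∃ B' ∈ C w, A = insert w B' := by
  by_cases hwA : w ∈ A
  · right
    obtain ⟨w', B', hB', rfl⟩ := hA
    have : w' = w := by
      rcases Finset.mem_insert.1 hwA with h | h
      · exact h.symm
      · rcases Finset.mem_insert.1 (hAB (Finset.mem_insert_self w' B')) with h2 | h2
        · exact h2
        · exact absurd ((hC w).lt_of_mem B hB w' h2) ((hC w').lt_of_mem B' hB' w h).asymm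
    subst this
    exact ⟨B', hB', rfl⟩
  · left
    intro x hx
    rcases Finset.mem_insert.1 (hAB hx) with rfl | h
    · exact absurd hx hwA
    · exact h

theorem exists_succ (hC : ∀ w, IsSaturatedAt C w) {w : V} {B B' : Finset V}
    (hB : B ∈ C w) (hB' : B' ∈ C w) (h : B'.card < B.card) :
    ∃ D ∈ C w, B' ⊆ D ∧ D ⊆ B ∧ D.card = B'.card + 1 := by
  have hsub : B' ⊆ B := by
    rcases (hC w).total B' hB' B hB with h' | h'
    · exact h'
    · exact absurd (Finset.card_le_card h') (by omega)
  induction hn : B.card - B'.card using Nat.strong_induction_on generalizing B with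
  | _ n ih =>
    by_cases h1 : B.card = B'.card + 1
    · exact ⟨B, hB, hsub, le_rfl, h1⟩
    obtain ⟨D, hD, hDB, hcard⟩ := (hC w).exists_pred B hB (Finset.card_pos.1 (by omega))
    have hB'D : B' ⊆ D := by
      rcases (hC w).total B' hB' D hD with h' | h'
      · exact h'
      · exact absurd (Finset.card_le_card h') (by omega)
    obtain ⟨D', hD', h2, h3, h4⟩ := ih (D.card - B'.card) (by omega) hD (by omega) hB'D rfl
    exact ⟨D', hD', h2, h3.trans hDB, h4⟩

theorem exists_mem_card_eq (hC : ∀ w, IsSaturatedAt C w) {A : Finset V}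
    (hA : A ∈ chainFamily C) {i : ℕ} (hi : 1 ≤ i) (hiA : i ≤ A.card) :
    ∃ D ∈ chainFamily C, D ⊆ A ∧ D.card = i := by
  obtain ⟨w, B, hB, rfl⟩ := hA
  rw [card_insert_of_saturated hC hB] at hiA
  induction hn : B.card generalizing B with
  | zero => exact ⟨_, ⟨w, B, hB, rfl⟩, le_rfl, by rw [card_insert_of_saturated hC hB]; omega⟩
  | succ n ih =>
    by_cases h : i = B.card + 1
    · exact ⟨_, ⟨w, B, hB, rfl⟩, le_rfl, by rw [card_insert_of_saturated hC hB, h]⟩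
    obtain ⟨B', hB', hsub, hcard⟩ := (hC w).exists_pred B hB (Finset.card_pos.1 (by omega))
    obtain ⟨D, hD, h1, h2⟩ := ih B' hB' (by omega) (by omega)
    exact ⟨D, hD, h1.trans (Finset.insert_subset_insert _ hsub), h2⟩

theorem min_insert_of_saturated (hC : ∀ w, IsSaturatedAt C w) {w : V} {B : Finset V}
    (hB : B ∈ C w) : (insert w B).min = w := by
  refine le_antisymm (Finset.min_le (Finset.mem_insert_self _ _)) (Finset.le_min fun x hx => ?_)
  rcases Finset.mem_insert.1 hx with rfl | h
  · exact le_rfl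
  · exact WithTop.coe_le_coe.2 ((hC w).lt_of_mem B hB x h).le

theorem lt_min_of_saturated (hC : ∀ w, IsSaturatedAt C w) {w : V} {B : Finset V}
    (hB : B ∈ C w) : (w : WithTop V) < B.min := by
  rcases B.eq_empty_or_nonempty with rfl | h
  · simp
  · obtain ⟨x, hx⟩ := Finset.min_of_nonempty h
    rw [hx]
    exact WithTop.coe_lt_coe.2 ((hC w).lt_of_mem B hB x (Finset.mem_of_min hx))

/-! ### The vine structure of the family and of its principal ideals -/

/-- `φ` identifies the poset `Q` with a lower set of the family of `C`. -/
structure IsFamilyIdeal (C : V → Set (Finset V)) {Q : Type u} [PartialOrder Q]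
    (φ : Q → Finset V) : Prop where
  saturated : ∀ w, IsSaturatedAt C w
  le_iff : ∀ x y, φ x ⊆ φ y ↔ x ≤ y
  mem : ∀ x, φ x ∈ chainFamily C
  lower : ∀ A ∈ chainFamily C, ∀ x, A ⊆ φ x → ∃ y, φ y = A

namespace IsFamilyIdeal
variable {Q : Type u} [PartialOrder Q] {φ : Q → Finset V}

theorem injective (h : IsFamilyIdeal C φ) : Function.Injective φ := fun x y hxy =>
  le_antisymm ((h.le_iff x y).1 hxy.le) ((h.le_iff y x).1 hxy.ge)

theorem ssubset_of_lt (h : IsFamilyIdeal C φ) {x y : Q} (hxy : x < y) : φ x ⊂ φ y :=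
  ⟨(h.le_iff x y).2 hxy.le, fun h' => hxy.not_ge ((h.le_iff y x).1 h')⟩

theorem covBy_iff (h : IsFamilyIdeal C φ) {x y : Q} :
    x ⋖ y ↔ φ x ⊆ φ y ∧ (φ x).card + 1 = (φ y).card := by
  constructor
  · intro hxy
    have hss := h.ssubset_of_lt hxy.lt
    obtain ⟨D, hD, h1, h2, h3⟩ := exists_between_of_ssubset h.saturated (h.mem x) (h.mem y) hss
    obtain ⟨z, rfl⟩ := h.lower D hD y h2
    have hzy : z < y := lt_of_le_of_ne ((h.le_iff z y).1 h2) fun e => by subst e; omega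
    obtain rfl : x = z := by
      by_contra hne
      exact hxy.2 (lt_of_le_of_ne ((h.le_iff x z).1 h1) hne) hzy
    exact ⟨hss.1, h3⟩
  · rintro ⟨h1, h2⟩
    refine ⟨lt_of_le_of_ne ((h.le_iff x y).1 h1) fun e => by subst e; omega, fun z hxz hzy => ?_⟩
    have h3 := Finset.card_lt_card (h.ssubset_of_lt hxz)
    have h4 := Finset.card_lt_card (h.ssubset_of_lt hzy)
    omega

theorem isMin_iff (h : IsFamilyIdeal C φ) {x : Q} : IsMin x ↔ (φ x).card = 1 := by
  constructor
  · intro hx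
    obtain ⟨D, hD, h1, h2⟩ := exists_mem_card_eq h.saturated (h.mem x) le_rfl
      (Finset.card_pos.2 (nonempty_of_mem_chainFamily (h.mem x)))
    obtain ⟨z, rfl⟩ := h.lower D hD x h1
    rw [le_antisymm (hx ((h.le_iff z x).1 h1)) ((h.le_iff z x).1 h1), h2]
  · intro hx y hy
    have hsub := (h.le_iff y x).2 hy
    have := Finset.card_pos.2 (nonempty_of_mem_chainFamily (h.mem y))
    exact (h.injective (Finset.eq_of_subset_of_card_le hsub (by omega))).ge

/-- A member inside `insert w B` either misses `w`, so lies in `B`, or has least element `w`, so its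
tail is in the chain `C w`. In codimension one each alternative leaves a single set. -/
theorem exists_coveredBy (h : IsFamilyIdeal C φ) {v : Q} {w : V} {B : Finset V}
    (hB : B ∈ C w) (hv : φ v = insert w B) (hne : B.Nonempty) :
    ∃ p q B', φ p = B ∧ B' ∈ C w ∧ φ q = insert w B' ∧ B' ⊆ B ∧ B'.card + 1 = B.card ∧
      p ≠ q ∧ Vine.coveredBy v = {p, q} := by
  have hcard := card_insert_of_saturated h.saturated hB
  obtain ⟨p, hp⟩ := h.lower B (mem_chainFamily_of_nonempty h.saturated hB hne) v
    (hv ▸ Finset.subset_insert _ _)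
  obtain ⟨B', hB', hsub, hc'⟩ := (h.saturated w).exists_pred B hB hne
  have hcard' := card_insert_of_saturated h.saturated hB'
  obtain ⟨q, hq⟩ := h.lower (insert w B') ⟨w, B', hB', rfl⟩ v
    (hv ▸ Finset.insert_subset_insert _ hsub)
  refine ⟨p, q, B', hp, hB', hq, hsub, hc', ?_, ?_⟩
  · rintro rfl
    have : w ∈ B := by rw [← hp, hq]; exact Finset.mem_insert_self _ _
    exact lt_irrefl _ ((h.saturated w).lt_of_mem B hB w this)
  · ext x
    simp only [Vine.coveredBy, Set.mem_ofPred_eq, Set.mem_insert_iff, Set.mem_singleton_iff]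
    rw [h.covBy_iff, hv, hcard]
    constructor
    · rintro ⟨h1, h2⟩
      rcases eq_insert_of_subset h.saturated (h.mem x) hB h1 with h3 | ⟨B'', hB'', h3⟩
      · left
        apply h.injective
        rw [hp]
        exact Finset.eq_of_subset_of_card_le h3 (by omega)
      · right
        apply h.injective
        have := card_insert_of_saturated h.saturated hB''
        rw [h3] at h2
        rw [h3, hq, eq_of_card_eq h.saturated hB'' hB' (by omega)]
    · rintro (rfl | rfl)
      · rw [hp]; exact ⟨Finset.subset_insert _ _, rfl⟩
      · rw [hq]; exact ⟨Finset.insert_subset_insert _ hsub, by omega⟩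

theorem card_pos (h : IsFamilyIdeal C φ) (x : Q) : 0 < (φ x).card :=
  Finset.card_pos.2 (nonempty_of_mem_chainFamily (h.mem x))

theorem isRankFunction (h : IsFamilyIdeal C φ) : Vine.IsRankFunction Q fun x => (φ x).card where
  lt_of_lt _ _ hxy := Finset.card_lt_card (h.ssubset_of_lt hxy)
  covBy _ _ hxy := (h.covBy_iff.1 hxy).2.symm
  of_isMin _ hx := h.isMin_iff.1 hx

theorem union_eq (h : IsFamilyIdeal C φ) {a b v : Q} (hab : a ≠ b)
    (hcard : (φ a).card = (φ b).card) (ha : a ⋖ v) (hb : b ⋖ v) : φ a ∪ φ b = φ v := by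
  obtain ⟨ha1, ha2⟩ := h.covBy_iff.1 ha
  obtain ⟨hb1, hb2⟩ := h.covBy_iff.1 hb
  refine Finset.eq_of_subset_of_card_le (Finset.union_subset ha1 hb1) ?_
  by_contra hlt
  have h1 : φ a = φ a ∪ φ b :=
    Finset.eq_of_subset_of_card_le Finset.subset_union_left (by omega)
  have h2 : φ b = φ a ∪ φ b :=
    Finset.eq_of_subset_of_card_le Finset.subset_union_right (by omega)
  exact hab (h.injective (h1.trans h2.symm))

/-- The two ends of an edge have different least elements. The end with the smaller one, `w`,
determines the other, which is the member of `C w` of cardinality `i`. -/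
theorem isAcyclic (h : IsFamilyIdeal C φ) (i : ℕ) :
    (Vine.assocGraph Q (fun x => (φ x).card) i).IsAcyclic := by
  have key : ∀ x y : {x : Q // (φ x).card = i},
      (Vine.assocGraph Q (fun x => (φ x).card) i).Adj x y → (φ x.1).min ≤ (φ y.1).min →
      ∃ w : V, (φ x.1).min = w ∧ φ y.1 ∈ C w := by
    rintro ⟨x, hx⟩ ⟨y, hy⟩ ⟨hxy, v, hv, hcov⟩ hle
    obtain ⟨w, B, hB, hvB⟩ := h.mem v
    have hcard := card_insert_of_saturated h.saturated hB
    have hpos := h.card_pos x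
    have hne : B.Nonempty := Finset.card_pos.1 (by
      have : (φ v).card = i + 1 := hv
      rw [hvB] at this
      omega)
    obtain ⟨p, q, B', hp, hB', hq, -, -, hpq, hcov'⟩ := h.exists_coveredBy hB hvB hne
    have hxy' : x ≠ y := fun e => hxy (Subtype.ext e)
    have hmem : ({x, y} : Set Q) = {p, q} := hcov.symm.trans hcov'
    have hmin : (φ q).min = w := by rw [hq]; exact min_insert_of_saturated h.saturated hB'
    rcases Set.pair_eq_pair_iff.1 hmem with ⟨rfl, rfl⟩ | ⟨rfl, rfl⟩
    · have h1 := lt_min_of_saturated h.saturated hB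
      rw [← hp, ← hmin] at h1
      exact absurd hle (not_le.2 h1)
    · exact ⟨w, hmin, by rw [hp]; exact hB⟩
  refine SimpleGraph.isAcyclic_of_unique_larger (fun x => (φ x.1).min) ?_
  intro x y z hxy hxz h1 h2
  obtain ⟨w, hw, hy⟩ := key x y hxy h1
  obtain ⟨w', hw', hz⟩ := key x z hxz h2
  obtain rfl : w = w' := WithTop.coe_injective (hw.symm.trans hw')
  exact Subtype.ext (h.injective (eq_of_card_eq h.saturated hy hz (y.2.trans z.2.symm)))

theorem isVine [Finite V] [Nonempty Q] (h : IsFamilyIdeal C φ) :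
    Vine.IsVine Q fun x => (φ x).card where
  finite := Finite.of_injective φ h.injective
  nonempty := inferInstance
  graded := h.isRankFunction
  covers_two v hv := by
    obtain ⟨w, B, hB, hvB⟩ := h.mem v
    have hcard := card_insert_of_saturated h.saturated hB
    have hne : B.Nonempty := by
      rw [Finset.nonempty_iff_ne_empty]
      rintro rfl
      exact hv (h.isMin_iff.2 (by rw [hvB, hcard]; rfl))
    obtain ⟨p, q, -, -, -, -, -, -, hpq, hcov⟩ := h.exists_coveredBy hB hvB hne
    rw [hcov, Set.ncard_pair hpq]
  covered_unique a b hab hcard v w hav hbv haw hbw :=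
    h.injective ((h.union_eq hab hcard hav hbv).symm.trans (h.union_eq hab hcard haw hbw))
  forest i _ _ := h.isAcyclic i

/-- The two sets covered by `insert w B` are `B` and `insert w B'`, and both cover `B'`; `2 ≤ i`
makes `B'` non-empty, hence a member of the family. -/
theorem proximity (h : IsFamilyIdeal C φ) (i : ℕ) (hi : 2 ≤ i) (a b : Q) (hab : a ≠ b)
    (ha : (φ a).card = i) (hv : ∃ v : Q, a ⋖ v ∧ b ⋖ v) : ∃ c : Q, c ⋖ a ∧ c ⋖ b := by
  obtain ⟨v, hav, hbv⟩ := hv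
  obtain ⟨w, B, hB, hvB⟩ := h.mem v
  have hcard := card_insert_of_saturated h.saturated hB
  have hac := (h.covBy_iff.1 hav).2
  rw [hvB] at hac
  obtain ⟨p, q, B', hp, hB', hq, hsub, hc', hpq, hcov⟩ :=
    h.exists_coveredBy hB hvB (Finset.card_pos.1 (by omega))
  obtain ⟨c, hc⟩ := h.lower B' (mem_chainFamily_of_nonempty h.saturated hB'
    (Finset.card_pos.1 (by omega))) p (hp ▸ hsub)
  have hcp : c ⋖ p := h.covBy_iff.2 (by rw [hc, hp]; exact ⟨hsub, hc'⟩)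
  have hcq : c ⋖ q := h.covBy_iff.2 (by
    rw [hc, hq, card_insert_of_saturated h.saturated hB']
    exact ⟨Finset.subset_insert _ _, rfl⟩)
  have ha' : a ∈ ({p, q} : Set Q) := hcov ▸ hav
  have hb' : b ∈ ({p, q} : Set Q) := hcov ▸ hbv
  simp only [Set.mem_insert_iff, Set.mem_singleton_iff] at ha' hb'
  rcases ha' with rfl | rfl <;> rcases hb' with rfl | rfl
  · exact absurd rfl hab
  · exact ⟨c, hcp, hcq⟩
  · exact ⟨c, hcq, hcp⟩
  · exact absurd rfl hab

/-- By induction on `b = insert w B`, everything of rank `i` below `b` is moved into the tail `B`: a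
set `insert w B'` is adjacent to the successor `D` of `B'` in `C w`, through the element `insert w
D`. -/
theorem reachable (h : IsFamilyIdeal C φ) {i : ℕ} (b : Q) (x y : {x : Q // (φ x).card = i})
    (hx : x.1 ≤ b) (hy : y.1 ≤ b) :
    (Vine.assocGraph Q (fun x => (φ x).card) i).Reachable x y := by
  induction hn : (φ b).card generalizing b x y with
  | zero => exact absurd hn (h.card_pos b).ne'
  | succ n ih =>
    obtain ⟨w, B, hB, hbB⟩ := h.mem b
    have hcard := card_insert_of_saturated h.saturated hB
    rw [← hbB] at hcard
    have hxi := x.2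
    have hyi := y.2
    have hle := Finset.card_le_card ((h.le_iff _ _).2 hx)
    by_cases hib : i = (φ b).card
    · have : ∀ z : {x : Q // (φ x).card = i}, z.1 ≤ b → z.1 = b := fun z hz =>
        h.injective (Finset.eq_of_subset_of_card_le ((h.le_iff _ _).2 hz) (by
          rw [z.2, hib]))
      rw [Subtype.ext ((this x hx).trans (this y hy).symm)]
    have hpos := h.card_pos x.1
    have hne : B.Nonempty := Finset.card_pos.1 (by omega)
    obtain ⟨p, hp⟩ := h.lower B (mem_chainFamily_of_nonempty h.saturated hB hne) b
      (hbB ▸ Finset.subset_insert _ _)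
    have key : ∀ z : {x : Q // (φ x).card = i}, z.1 ≤ b → ∃ z' : {x : Q // (φ x).card = i},
        z'.1 ≤ p ∧ (Vine.assocGraph Q (fun x => (φ x).card) i).Reachable z z' := by
      intro z hz
      have hzi := z.2
      rcases eq_insert_of_subset h.saturated (h.mem z.1) hB (hbB ▸ (h.le_iff _ _).2 hz) with
        h1 | ⟨B', hB', h1⟩
      · exact ⟨z, (h.le_iff _ _).1 (hp ▸ h1), SimpleGraph.Reachable.refl _⟩
      · have hc' := card_insert_of_saturated h.saturated hB'
        rw [← h1] at hc'
        obtain ⟨D, hD, h2, h3, h4⟩ := exists_succ h.saturated hB hB' (by omega)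
        have hDcard := card_insert_of_saturated h.saturated hD
        have hDne : D.Nonempty := Finset.card_pos.1 (by omega)
        obtain ⟨v, hv⟩ := h.lower (insert w D) ⟨w, D, hD, rfl⟩ b
          (hbB ▸ Finset.insert_subset_insert _ h3)
        obtain ⟨p', q', D', hp', hD', hq', -, h5, hpq, hcov⟩ := h.exists_coveredBy hD hv hDne
        have hq'z : q' = z.1 := h.injective (by
          rw [hq', h1, eq_of_card_eq h.saturated hD' hB' (by omega)])
        refine ⟨⟨p', by rw [hp']; omega⟩, (h.le_iff _ _).1 (by rw [hp', hp]; exact h3),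
          SimpleGraph.Adj.reachable ⟨fun e => hpq ?_, v, ?_, ?_⟩⟩
        · rw [hq'z, e]
        · change (φ v).card = i + 1
          rw [hv]; omega
        · rw [hcov, hq'z, Set.pair_comm]
    obtain ⟨x', hx', hxx'⟩ := key x hx
    obtain ⟨y', hy', hyy'⟩ := key y hy
    exact hxx'.trans ((ih p x' y' hx' hy' (by rw [hp]; omega)).trans hyy'.symm)

theorem rank_eq [Finite V] (h : IsFamilyIdeal C φ) (t : Q) (ht : ∀ x, x ≤ t) :
    Vine.rank Q (fun x => (φ x).card) = (φ t).card := by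
  have : Nonempty Q := ⟨t⟩
  have hle : ∀ x, (φ x).card ≤ (φ t).card := fun x =>
    Finset.card_le_card ((h.le_iff _ _).2 (ht x))
  exact le_antisymm (ciSup_le hle) (le_ciSup (f := fun x => (φ x).card)
    ⟨_, Set.forall_mem_range.2 hle⟩ t)

theorem exists_singleton (h : IsFamilyIdeal C φ) (t : Q) {v : V} (hv : v ∈ φ t) :
    ∃ x, φ x = {v} :=
  h.lower {v} ⟨v, ∅, (h.saturated v).empty_mem, rfl⟩ t (Finset.singleton_subset_iff.2 hv)

theorem dim_eq (h : IsFamilyIdeal C φ) (t : Q) (ht : ∀ x, x ≤ t) :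
    Vine.dim Q = (φ t).card := by
  unfold Vine.dim
  have himg : φ '' {x | IsMin x} = (fun v => ({v} : Finset V)) '' (φ t : Set V) := by
    ext A
    constructor
    · rintro ⟨x, hx, rfl⟩
      obtain ⟨v, hv⟩ := Finset.card_eq_one.1 (h.isMin_iff.1 hx)
      refine ⟨v, (h.le_iff _ _).2 (ht x) ?_, hv.symm⟩
      rw [hv]; exact Finset.mem_singleton_self v
    · rintro ⟨v, hv, rfl⟩
      obtain ⟨x, hx⟩ := h.exists_singleton t hv
      exact ⟨x, h.isMin_iff.2 (by rw [hx]; rfl), hx⟩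
  rw [← Set.ncard_image_of_injective _ h.injective, himg,
    Set.ncard_image_of_injective _ Finset.singleton_injective, Set.ncard_coe_finset]

theorem isRVine [Finite V] (h : IsFamilyIdeal C φ) (t : Q) (ht : ∀ x, x ≤ t) :
    Vine.IsRVine Q fun x => (φ x).card := by
  have : Nonempty Q := ⟨t⟩
  refine ⟨h.isVine, (h.rank_eq t ht).trans (h.dim_eq t ht).symm, fun i hi hit => ⟨?_, h.isAcyclic i⟩,
    fun i hi a b hab ha _ hv => h.proximity i hi a b hab ha hv⟩
  rw [h.rank_eq t ht] at hit
  obtain ⟨D, hD, hDt, hcard⟩ := exists_mem_card_eq h.saturated (h.mem t) hi hit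
  obtain ⟨x, rfl⟩ := h.lower D hD t hDt
  have : Nonempty {x : Q // (φ x).card = i} := ⟨⟨x, hcard⟩⟩
  exact ⟨fun x y => h.reachable t x y (ht _) (ht _)⟩

/-- A principal ideal is again a lower part of the same family, now with a greatest element, so
`isRVine` applies to it directly. -/
theorem isLRVine [Finite V] [Nonempty Q] (h : IsFamilyIdeal C φ) :
    Vine.IsLRVine Q fun x => (φ x).card := by
  refine ⟨h.isVine, fun a => ?_⟩
  have ha : IsFamilyIdeal C (fun x : Set.Iic a => φ x.1) := by
    refine ⟨h.saturated, fun x y => h.le_iff x.1 y.1, fun x => h.mem x.1, fun A hA x hAx => ?_⟩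
    obtain ⟨y, rfl⟩ := h.lower A hA x.1 hAx
    exact ⟨⟨y, ((h.le_iff _ _).1 hAx).trans x.2⟩, rfl⟩
  exact ha.isRVine ⟨a, le_rfl⟩ fun x => x.2

end IsFamilyIdeal
end

/-! ### Maximal members and maximal cliques -/

section
variable {V : Type u} [LinearOrder V] {G : SimpleGraph V} {C : V → Set (Finset V)}

theorem isClique_of_mem_chainFamily (hP : G.IsPerfectElimination)
    (hC : ∀ w, G.ChainCondition C w) {A : Finset V} (hA : A ∈ chainFamily C) :
    G.IsClique (A : Set V) := by
  obtain ⟨w, B, hB, rfl⟩ := hA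
  have hlt := (hC w).saturated.lt_of_mem B hB
  have hadj := (hC w).adj B hB
  rw [Finset.coe_insert, SimpleGraph.isClique_insert]
  refine ⟨fun x hx y hy hxy => ?_, fun x hx _ => hadj x hx⟩
  exact hP.adj (hlt x hx) (hlt y hy) hxy (Or.inr (hadj x hx)) (Or.inr (hadj y hy))

theorem exists_mem_chainFamily_of_isClique [Finite V] (hC : ∀ w, G.ChainCondition C w)
    {K : Set V} (hK : G.IsClique K) (hne : K.Nonempty) :
    ∃ A ∈ chainFamily C, K ⊆ (A : Set V) := by
  classical
  have := Fintype.ofFinite V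
  obtain ⟨w, hwK, hw⟩ := Set.exists_min_image K id (Set.toFinite K) hne
  let B : Finset V := Finset.univ.filter fun x => w < x ∧ G.Adj w x
  -- The case `v = u` of `later_mem` puts the full set of later neighbours of `w` into `C w`.
  refine ⟨insert w B, ⟨w, B, (hC w).later_mem w le_rfl (Or.inl rfl) B (by simp [B]), rfl⟩, ?_⟩
  intro x hx
  by_cases hxw : x = w
  · simp [hxw]
  · have : w < x := lt_of_le_of_ne (hw x hx) (Ne.symm hxw)
    simp [B, this, hK hwK hx (Ne.symm hxw)]

theorem bijOn_maximalCliques [Finite V] [Nonempty V] (hP : G.IsPerfectElimination)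
    (hC : ∀ w, G.ChainCondition C w) :
    Set.BijOn (fun a : {A // A ∈ chainFamily C} => ((a : Finset V) : Set V)) {a | IsMax a}
      (maximalCliques G) := by
  have hclique : ∀ a : {A // A ∈ chainFamily C}, G.IsClique ((a : Finset V) : Set V) :=
    fun a => isClique_of_mem_chainFamily hP hC a.2
  refine ⟨fun a ha => ⟨hclique a, fun K hK haK => ?_⟩, ?_, fun K hK => ?_⟩
  · obtain ⟨A, hA, hKA⟩ := exists_mem_chainFamily_of_isClique hC hK
      (Set.Nonempty.mono haK (nonempty_of_mem_chainFamily a.2))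
    have haA : a ≤ ⟨A, hA⟩ := Finset.coe_subset.1 (haK.trans hKA)
    exact hKA.trans (Finset.coe_subset.2 (ha haA))
  · exact fun a _ b _ hab => Subtype.ext (Finset.coe_injective hab)
  -- The empty clique is not maximal because there is a vertex.
  · have hKne : K.Nonempty := by
      by_contra hemp
      rw [Set.not_nonempty_iff_eq_empty] at hemp
      subst hemp
      obtain ⟨v⟩ := ‹Nonempty V›
      exact hK.2 (y := {v}) (SimpleGraph.isClique_singleton v) (Set.empty_subset _)
        (Set.mem_singleton v)
    obtain ⟨A, hA, hKA⟩ := exists_mem_chainFamily_of_isClique hC hK.1 hKne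
    have hAK := hK.2 (isClique_of_mem_chainFamily hP hC hA) hKA
    refine ⟨⟨A, hA⟩, fun b hb => ?_, hAK.antisymm hKA⟩
    exact Finset.coe_subset.1 ((hK.2 (hclique b) (hKA.trans (Finset.coe_subset.2 hb))).trans hKA)

end

theorem Set.BijOn.maximalPrincipalIdeals {P : Type u} {W : Type*} [PartialOrder P]
    {e : W → P} {T : Set (Set W)}
    (h : Set.BijOn (fun a : P => {v : W | e v ≤ a}) {a | IsMax a} T) :
    Set.BijOn (fun I : Set P => {v : W | e v ∈ I}) (maximalPrincipalIdeals P) T := by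
  refine ⟨?_, ?_, fun K hK => ?_⟩
  · rintro I ⟨a, ha, rfl⟩
    exact h.mapsTo ha
  · rintro I ⟨a, ha, rfl⟩ J ⟨b, hb, rfl⟩ hab
    rw [h.injOn ha hb hab]
  · obtain ⟨a, ha, rfl⟩ := h.surjOn hK
    exact ⟨Set.Iic a, ⟨a, ha, rfl⟩, rfl⟩

/-- Every strongly chordal graph `G` has an LR-vine `P` whose minimal nodes are (via `e`) the
vertices of `G`, such that sending a maximal node `a` of `P`, respectively the principal ideal
generated by it, to the set of the minimal nodes it lies above, respectively contains, is a
bijection onto the set of the maximal cliques of `G`. -/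
theorem mainTheorem10 {V : Type u} [Finite V] [Nonempty V] (G : SimpleGraph V)
    (hG : IsStronglyChordal G) :
    ∃ (P : Type u) (_ : PartialOrder P) (rk : P → ℕ) (e : V ≃ {x : P // IsMin x}),
      Vine.IsLRVine P rk ∧
      Set.BijOn (fun a : P => {v : V | (e v : P) ≤ a}) {a : P | IsMax a} (maximalCliques G) ∧
      Set.BijOn (fun I : Set P => {v : V | (e v : P) ∈ I})
        (maximalPrincipalIdeals P) (maximalCliques G) := by
  obtain ⟨_, hL⟩ := G.exists_isDoublyLexical
  have := Fintype.ofFinite V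
  have hP := hL.isPerfectElimination hG.1
  obtain ⟨C, hC⟩ := SimpleGraph.exists_chainCondition hP (hL.isStrongElimination hP hG.2)
  have hideal : IsFamilyIdeal C (fun a : {A // A ∈ chainFamily C} => (a : Finset V)) :=
    ⟨fun w => (hC w).saturated, fun _ _ => Iff.rfl, fun a => a.2, fun A hA _ _ => ⟨⟨A, hA⟩, rfl⟩⟩
  have hsing : ∀ v : V, {v} ∈ chainFamily C := fun v => ⟨v, ∅, (hC v).saturated.empty_mem, rfl⟩
  have : Nonempty {A // A ∈ chainFamily C} := ⟨⟨_, hsing (Classical.arbitrary V)⟩⟩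
  -- Since `∅ ∈ C v`, every singleton is in the family, and singletons are its minimal members.
  let e : V → {x : {A // A ∈ chainFamily C} // IsMin x} := fun v =>
    ⟨⟨{v}, hsing v⟩, hideal.isMin_iff.2 (Finset.card_singleton v)⟩
  have he : Function.Bijective e := by
    refine ⟨fun v w h => ?_, fun x => ?_⟩
    · exact Finset.singleton_injective (congrArg (fun x => x.1.1) h)
    · obtain ⟨v, hv⟩ := Finset.card_eq_one.1 (hideal.isMin_iff.1 x.2)
      exact ⟨v, Subtype.ext (Subtype.ext hv.symm)⟩
  have hbij : Set.BijOn (fun a : {A // A ∈ chainFamily C} =>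
      {v : V | (Equiv.ofBijective e he v : {A // A ∈ chainFamily C}) ≤ a}) {a | IsMax a}
      (maximalCliques G) := by
    refine (bijOn_maximalCliques hP hC).congr fun a _ => ?_
    ext v
    exact Finset.singleton_subset_iff.symm
  exact ⟨{A // A ∈ chainFamily C}, inferInstance, fun a => (a : Finset V).card,
    Equiv.ofBijective e he, hideal.isLRVine, hbij, hbij.maximalPrincipalIdeals⟩
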